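/- Let $k,d$ be nonnegative integers, let $\|\cdot\|$ be any norm on $\mathbb{R}^d$, and let $\alpha\in(0,\infty)$. Let $(\mathbf X(\mathbf t):\mathbf t\in\mathbb Z^k)$ be an $\mathbb R^d$-valued (strictly) stationary random field such that $\|\mathbf X(\mathbf 0)\|$ is regularly varying with index $\alpha$, i.e. $\mathbb P(\|\mathbf X(\mathbf 0)\|>ux)/\mathbb P(\|\mathbf X(\mathbf 0)\|>x)\to u^{-\alpha}$ as $x\to\infty$ for every $u>0$. The field $\mathbf X$ is called jointly regularly varying with index $\alpha$ if for all $n\ge 1$ and $\mathbf t_1,\dots,\mathbf t_n\in\mathbb Z^k$ the random vector $\mathbf Z=(\mathbf X(\mathbf t_1),\dots,\mathbf X(\mathbf t_n))$ is regularly varying with index $\alpha$ in $\mathbb R^{nd}$: there are a measurable function $V:(0,\infty)\to(0,\infty)$ with $V(ux)/V(x)\to u^{-\alpha}$ as $x\to\infty$ for every $u>0$, and a nonzero Radon measure $\mu$ on $[-\infty,\infty]^{nd}\setminus\{\mathbf 0\}$ that does not charge the points with an infinite coordinate, such that $\mathbb P(x^{-1}\mathbf Z\in\cdot)/V(x)\to\mu$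 vaguely on $[-\infty,\infty]^{nd}\setminus\{\mathbf 0\}$ as $x\to\infty$. Then $\mathbf X$ is jointly regularly varying with index $\alpha$ if and only if there exists an $\mathbb R^d$-valued random field $(\mathbf\Theta(\mathbf t):\mathbf t\in\mathbb Z^k)$ such that $$\mathcal L\left(\frac{\mathbf X(\mathbf t)}{\|\mathbf X(\mathbf 0)\|}:\mathbf t\in\mathbb Z^k\,\middle|\,\|\mathbf X(\mathbf 0)\|>x\right)\to\mathcal L(\mathbf\Theta(\mathbf t):\mathbf t\in\mathbb Z^k)\qquad\text{as }x\to\infty$$ in the sense of convergence of the finite-dimensional distributions. Moreover, any such $\mathbf\Theta$ is the spectral field of $\mathbf X$, that is, it has the law of $(\mathbf Y(\mathbf t)/\|\mathbf Y(\mathbf 0)\|:\mathbf t\in\mathbb Z^k)$, where $(\mathbf Y(\mathbf t):\mathbf t\in\mathbb Z^k)$ is the tail field of $\mathbf X$: a random field with $\mathcal L(x^{-1}\mathbf X(\mathbf t):\mathbf t\in\mathbb Z^k\mid\|\mathbf X(\mathbf 0)\|>x)\to\mathcal L(\mathbf Y(\mathbf t):\mathbf t\in\mathbb Z^k)$ as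 $x\to\infty$ in the sense of finite-dimensional distributions, and $\mathbb P(\|\mathbf Y(\mathbf 0)\|>y)=y^{-\alpha}$ for all $y\ge 1$. -/

import Mathlib

open MeasureTheory ProbabilityTheory Filter Topology
open scoped BoundedContinuousFunction

/-- A function `V` on `(0, ∞)` is regularly varying at infinity with exponent `ρ`. -/
structure RegularlyVaryingFun (V : ℝ → ℝ) (ρ : ℝ) : Prop where
  measurable : Measurable V
  pos : ∀ x : ℝ, 0 < x → 0 < V x
  tendsto_ratio : ∀ u : ℝ, 0 < u →
    Tendsto (fun x : ℝ => V (u * x) / V x) atTop (𝓝 (u ^ ρ))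

/-- A nonnegative random variable `R` is regularly varying with index `α`: its tail
`x ↦ ℙ(R > x)` is a regularly varying function with exponent `-α`. -/
def RegularlyVaryingVariable {Ω : Type*} [MeasurableSpace Ω] (P : Measure Ω)
    (R : Ω → ℝ) (α : ℝ) : Prop :=
  RegularlyVaryingFun (fun x => P.real {ω | x < R ω}) (-α)

/-- The punctured extended space `[-∞, ∞]^J \ {0}` with its subspace topology and Borel
σ-algebra. -/
abbrev PuncturedExtended (J : Type*) : Type _ := {y : J → EReal // y ≠ 0}

/-- Vague convergence `ν x → μ` as `x → ∞`: the integrals of all compactly supported continuous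
functions converge. -/
def VagueTendsto {S : Type*} [TopologicalSpace S] [MeasurableSpace S]
    (ν : ℝ → Measure S) (μ : Measure S) : Prop :=
  ∀ f : S → ℝ, Continuous f → HasCompactSupport f →
    Tendsto (fun x => ∫ y, f y ∂(ν x)) atTop (𝓝 (∫ y, f y ∂μ))

/-- The measure `ℙ(x⁻¹ Z ∈ ·)` on `[-∞, ∞]^J \ {0}`. -/
noncomputable def scaledLaw {Ω J : Type*} [MeasurableSpace Ω] (P : Measure Ω)
    (Z : Ω → J → ℝ) (x : ℝ) : Measure (PuncturedExtended J) :=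
  (P.map (fun ω j => ((x⁻¹ * Z ω j : ℝ) : EReal))).comap Subtype.val

/-- The random vector `Z` in `ℝ^J` (`J` finite) is regularly varying with index `α`:
`ℙ(x⁻¹ Z ∈ ·) / V x` converges vaguely on `[-∞, ∞]^J \ {0}` to a nonzero Radon measure which does
not charge infinite points, where `V` is regularly varying with exponent `-α`. On this locally
compact space with countable base, the Radon measures are the Borel measures which are finite on
compact sets. -/
def RegularlyVaryingVector {Ω J : Type*} [MeasurableSpace Ω] [Fintype J] (P : Measure Ω)
    (Z : Ω → J → ℝ) (α : ℝ) : Prop :=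
  ∃ (V : ℝ → ℝ) (μ : Measure (PuncturedExtended J)),
    RegularlyVaryingFun V (-α) ∧
    IsFiniteMeasureOnCompacts μ ∧
    μ ≠ 0 ∧
    μ {y | ∃ j, y.1 j = ⊤ ∨ y.1 j = ⊥} = 0 ∧
    VagueTendsto (fun x => ENNReal.ofReal (V x)⁻¹ • scaledLaw P Z x) μ

/-- The random field `X` is jointly regularly varying with index `α`: every vector
`(X(t₁), …, X(tₙ))`, `n ≥ 1`, is regularly varying with index `α` in `ℝ^{nd}`. -/
def JointlyRegularlyVarying {Ω T : Type*} {d : ℕ} [MeasurableSpace Ω] (P : Measure Ω)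
    (X : T → Ω → Fin d → ℝ) (α : ℝ) : Prop :=
  ∀ (n : ℕ) (_ : 0 < n) (t : Fin n → T),
    RegularlyVaryingVector P (fun ω (q : Fin n × Fin d) => X (t q.1) ω q.2) α

/-- (Strict) stationarity: the law of the field is invariant under all shifts. -/
def StationaryField {Ω : Type*} {k d : ℕ} [MeasurableSpace Ω] (P : Measure Ω)
    (X : (Fin k → ℤ) → Ω → Fin d → ℝ) : Prop :=
  ∀ s : Fin k → ℤ, IdentDistrib (fun ω t => X (t + s) ω) (fun ω t => X t ω) P P

/-- Convergence, as `x → ∞`, of the finite-dimensional distributions of the field `Z x` under the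
probability measure `μ x` to those of the field `W` under `Q`. -/
def FddTendsto {Ω Ω' T E : Type*} [MeasurableSpace Ω] [MeasurableSpace Ω'] [TopologicalSpace E]
    (μ : ℝ → Measure Ω) (Z : ℝ → T → Ω → E) (Q : Measure Ω') (W : T → Ω' → E) : Prop :=
  ∀ (n : ℕ) (t : Fin n → T) (f : (Fin n → E) →ᵇ ℝ),
    Tendsto (fun x => ∫ ω, f (fun i => Z x (t i) ω) ∂(μ x)) atTop
      (𝓝 (∫ ω, f (fun i => W (t i) ω) ∂Q))

/-- `Law (X(t) / ‖X(0)‖ : t | ‖X(0)‖ > x) → Law (Θ(t) : t)` as `x → ∞`, in the sense of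
finite-dimensional distributions; the norm is `p`. -/
def AngularLimit {Ω Ω' : Type*} {k d : ℕ} [MeasurableSpace Ω] [MeasurableSpace Ω']
    (p : Seminorm ℝ (Fin d → ℝ)) (P : Measure Ω) (X : (Fin k → ℤ) → Ω → Fin d → ℝ)
    (Q : Measure Ω') (Θ : (Fin k → ℤ) → Ω' → Fin d → ℝ) : Prop :=
  FddTendsto (fun x => cond P {ω | x < p (X 0 ω)})
    (fun _ t ω => (p (X 0 ω))⁻¹ • X t ω) Q Θ

/-- `Y` is a tail field of `X`: `Law (x⁻¹ X(t) : t | ‖X(0)‖ > x) → Law (Y(t) : t)` as `x → ∞`, in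
the sense of finite-dimensional distributions, and `ℙ(‖Y(0)‖ > y) = y ^ (-α)` for `y ≥ 1`. -/
structure IsTailField {Ω Ω' : Type*} {k d : ℕ} [MeasurableSpace Ω] [MeasurableSpace Ω']
    (p : Seminorm ℝ (Fin d → ℝ)) (P : Measure Ω) (X : (Fin k → ℤ) → Ω → Fin d → ℝ) (α : ℝ)
    (Q : Measure Ω') (Y : (Fin k → ℤ) → Ω' → Fin d → ℝ) : Prop where
  isProbabilityMeasure : IsProbabilityMeasure Q
  measurable : ∀ t, Measurable (Y t)
  tendsto : FddTendsto (fun x => cond P {ω | x < p (X 0 ω)})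
    (fun x t ω => x⁻¹ • X t ω) Q Y
  pareto : ∀ y : ℝ, 1 ≤ y → Q.real {ω | y < p (Y 0 ω)} = y ^ (-α)

/-- `Θ` is (a version of) the spectral field of `X`: it has the law of `Y(t) / ‖Y(0)‖`, where `Y`
is the tail field of `X`. -/
def IsSpectralField {Ω Ω' : Type*} {k d : ℕ} [MeasurableSpace Ω] [MeasurableSpace Ω']
    (p : Seminorm ℝ (Fin d → ℝ)) (P : Measure Ω) (X : (Fin k → ℤ) → Ω → Fin d → ℝ) (α : ℝ)
    (Q : Measure Ω') (Θ : (Fin k → ℤ) → Ω' → Fin d → ℝ) : Prop :=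
  ∃ (Ω'' : Type) (_ : MeasurableSpace Ω'') (Q' : Measure Ω'')
    (Y : (Fin k → ℤ) → Ω'' → Fin d → ℝ),
    IsTailField p P X α Q' Y ∧
    IdentDistrib (fun ω t => Θ t ω) (fun ω t => (p (Y 0 ω))⁻¹ • Y t ω) Q Q'

/-! Write R = ‖X(0)‖ and W(x) = P(R > x). Everything rests on W(ux)/W(x) → u^(-α) together with
stationarity, which moves any large coordinate to the origin.

From Θ to the tail field (`RegularlyVaryingVariable.tendsto_radial_angular`): for an angular
quantity A and u ≥ 1, E[g(A); R > ux | R > x] = (W(ux)/W(x)) · E[g(A) | R > ux]. The right side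
tends to u^(-α) times the limit of E[g(A) | R > x], so R/x and the angular part become independent
and R/x becomes Pareto. Hence Y(t) = r Θ(t), with r Pareto and independent of Θ, is a tail field.
Since ‖Θ(0)‖ = 1 almost surely, dividing by ‖Y(0)‖ gives Θ back, which identifies Θ as the spectral
field.

From the tail field to joint regular variation (`StationaryField.exists_tendsto_of_tail`): a test
function G vanishing near 0 is cut by a partition of unity into pieces, the i-th of which lives
where the i-th coordinate is large. Shifting that coordinate to the origin turns its expectation
into one conditional on R > ex, which converges. The limits form a positive functional, and the
Riesz theorem supplies the measure. It is nonzero because P(R > 2x)/W(x) does not vanish in the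
limit, and has no mass at infinity by a union bound.

From joint regular variation to Θ: the normalisation V is comparable to W
(`StationaryField.exists_tendsto_of_regularlyVaryingVector`), and the indicator of R > x is
approximated by continuous cutoffs (`StationaryField.exists_tendsto_cond`), so the conditional
angular expectations converge. A limit law exists by Prokhorov's theorem on the countable product
(`StationaryField.exists_angularLimit`). -/

/-! ### Seminorms on finite-dimensional spaces -/

theorem Seminorm.continuous_of_finiteDimensional' {E : Type*} [NormedAddCommGroup E]
    [NormedSpace ℝ E] [FiniteDimensional ℝ E] (p : Seminorm ℝ E) : Continuous p :=
  continuousOn_univ.1 (p.convexOn.continuousOn isOpen_univ)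

theorem Seminorm.exists_le_mul_norm {E : Type*} [NormedAddCommGroup E]
    [NormedSpace ℝ E] [FiniteDimensional ℝ E] (p : Seminorm ℝ E) :
    ∃ C : ℝ, 0 < C ∧ ∀ v, p v ≤ C * ‖v‖ :=
  Seminorm.bound_of_continuous_normedSpace p p.continuous_of_finiteDimensional'

theorem Seminorm.exists_mul_norm_le {E : Type*} [NormedAddCommGroup E]
    [NormedSpace ℝ E] [FiniteDimensional ℝ E] (p : Seminorm ℝ E) (hp : ∀ v, p v = 0 → v = 0) :
    ∃ c : ℝ, 0 < c ∧ ∀ v, c * ‖v‖ ≤ p v := by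
  have hcpt : IsCompact (Metric.sphere (0 : E) 1) := isCompact_sphere 0 1
  -- The sphere is empty exactly when the space is trivial, which covers d = 0.
  rcases (Metric.sphere (0 : E) 1).eq_empty_or_nonempty with h | h
  · refine ⟨1, one_pos, fun v => ?_⟩
    have hv : v = 0 := by
      by_contra hv
      have : ‖v‖⁻¹ • v ∈ Metric.sphere (0 : E) 1 := by
        simp [norm_smul, inv_mul_cancel₀ (norm_ne_zero_iff.2 hv)]
      simp [h] at this
    simp [hv]
  · obtain ⟨w, hw, hmin⟩ := hcpt.exists_isMinOn h p.continuous_of_finiteDimensional'.continuousOn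
    have hw1 : ‖w‖ = 1 := by simpa using hw
    have hpos : 0 < p w := by
      refine lt_of_le_of_ne (apply_nonneg p w) fun h0 => ?_
      simp [hp w h0.symm] at hw1
    refine ⟨p w, hpos, fun v => ?_⟩
    by_cases hv : v = 0
    · simp [hv]
    · have hn : 0 < ‖v‖ := norm_pos_iff.2 hv
      have h1 : ‖v‖⁻¹ • v ∈ Metric.sphere (0 : E) 1 := by
        simp [norm_smul, inv_mul_cancel₀ hn.ne']
      have h2 : p w ≤ p (‖v‖⁻¹ • v) := hmin h1
      rw [map_smul_eq_mul, norm_inv, norm_norm, inv_mul_eq_div, le_div_iff₀ hn] at h2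
      exact h2

/-! ### Limits by approximation -/

theorem tendsto_of_approx {ι : Type*} {l : Filter ι} {u : ι → ℝ} {a : ℝ}
    (h : ∀ η : ℝ, 0 < η → ∃ (v : ι → ℝ) (b : ℝ), Tendsto v l (𝓝 b) ∧
      (∀ᶠ x in l, |u x - v x| ≤ η) ∧ |a - b| ≤ η) : Tendsto u l (𝓝 a) := by
  rw [Metric.tendsto_nhds]
  intro ε hε
  obtain ⟨v, b, hv, huv, hab⟩ := h (ε / 4) (by positivity)
  have hv' := Metric.tendsto_nhds.1 hv (ε / 4) (by positivity)
  filter_upwards [hv', huv] with x h1 h2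
  rw [Real.dist_eq] at *
  rw [abs_le] at h2 hab
  rw [abs_lt] at *
  constructor <;> linarith

/-- No candidate limit is at hand, so completeness of ℝ is used: being uniformly close to convergent
functions makes `u` Cauchy along `l`. -/
theorem exists_tendsto_of_approx {ι : Type*} {l : Filter ι} [l.NeBot] {u : ι → ℝ}
    (h : ∀ η : ℝ, 0 < η → ∃ v : ι → ℝ, (∃ b, Tendsto v l (𝓝 b)) ∧
      ∀ᶠ x in l, |u x - v x| ≤ η) : ∃ a, Tendsto u l (𝓝 a) := by
  rw [← cauchy_map_iff_exists_tendsto, Metric.cauchy_iff]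
  refine ⟨inferInstance, fun ε hε => ?_⟩
  obtain ⟨v, ⟨b, hv⟩, huv⟩ := h (ε / 8) (by positivity)
  have hv' := Metric.tendsto_nhds.1 hv (ε / 8) (by positivity)
  have hs : ∀ᶠ x in l, u x ∈ Metric.ball b (ε / 2) := by
    filter_upwards [hv', huv] with x h1 h2
    rw [Metric.mem_ball, Real.dist_eq] at *
    rw [abs_le] at h2
    rw [abs_lt] at *
    constructor <;> linarith
  refine ⟨Metric.ball b (ε / 2), hs, fun x hx y hy => ?_⟩
  calc dist x y ≤ dist x b + dist y b := dist_triangle_right _ _ _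
    _ < ε / 2 + ε / 2 := add_lt_add hx hy
    _ = ε := add_halves ε

/-! ### Tails of regularly varying random variables -/

section Tail

variable {Ω : Type*} [MeasurableSpace Ω] {P : Measure Ω} [IsProbabilityMeasure P]
  {R : Ω → ℝ} {α : ℝ}

theorem tail_antitone (P : Measure Ω) [IsProbabilityMeasure P] (R : Ω → ℝ) :
    Antitone fun x : ℝ => P.real {ω | x < R ω} := fun _ _ h =>
  measureReal_mono fun _ hω => lt_of_le_of_lt h hω

theorem RegularlyVaryingVariable.tail_pos (h : RegularlyVaryingVariable P R α) (x : ℝ) :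
    0 < P.real {ω | x < R ω} :=
  (h.pos (max x 1) (by positivity)).trans_le (tail_antitone P R (le_max_left x 1))

theorem RegularlyVaryingVariable.measure_ne_zero (h : RegularlyVaryingVariable P R α) (x : ℝ) :
    P {ω | x < R ω} ≠ 0 := fun h0 => by
  have := h.tail_pos x
  simp [measureReal_def, h0] at this

theorem RegularlyVaryingVariable.isProbabilityMeasure_cond (h : RegularlyVaryingVariable P R α)
    (x : ℝ) : IsProbabilityMeasure (cond P {ω | x < R ω}) :=
  cond_isProbabilityMeasure (h.measure_ne_zero x)

theorem RegularlyVaryingVariable.exists_small (h : RegularlyVaryingVariable P R α) (hα : 0 < α)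
    {ε : ℝ} (hε : 0 < ε) : ∃ u : ℝ, 1 ≤ u ∧
      ∀ᶠ x in atTop, P.real {ω | u * x < R ω} ≤ ε * P.real {ω | x < R ω} := by
  have h1 : Tendsto (fun u : ℝ => u ^ (-α)) atTop (𝓝 0) := tendsto_rpow_neg_atTop hα
  obtain ⟨u, hu, hu1⟩ := ((h1.eventually_lt_const hε).and (eventually_ge_atTop 1)).exists
  refine ⟨u, hu1, ?_⟩
  filter_upwards [(h.tendsto_ratio u (by linarith)).eventually_lt_const hu] with x hx
  exact ((div_lt_iff₀ (h.tail_pos x)).1 hx).le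

theorem RegularlyVaryingVariable.exists_tail_le (h : RegularlyVaryingVariable P R α) (hα : 0 < α)
    {ε : ℝ} (hε : 0 < ε) : ∃ y : ℝ, P.real {ω | y < R ω} ≤ ε := by
  obtain ⟨u, -, hu⟩ := h.exists_small hα hε
  obtain ⟨x, hx⟩ := hu.exists
  exact ⟨u * x, hx.trans (mul_le_of_le_one_right hε.le measureReal_le_one)⟩

/-- Regular variation controls only large x. For x between 1 and the threshold `x₁`, monotonicity of
the tail suffices once M exceeds a point `y` whose tail is below ε times the tail at `x₁`.
Uniformity is what tightness of the whole family x ≥ 1 needs. -/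
theorem RegularlyVaryingVariable.exists_uniform_small (h : RegularlyVaryingVariable P R α)
    (hα : 0 < α) {ε : ℝ} (hε : 0 < ε) : ∃ M : ℝ, 1 ≤ M ∧
      ∀ x, 1 ≤ x → P.real {ω | M * x < R ω} ≤ ε * P.real {ω | x < R ω} := by
  obtain ⟨u, hu1, hu⟩ := h.exists_small hα hε
  obtain ⟨x₁, hx₁⟩ := eventually_atTop.1 hu
  obtain ⟨y, hy⟩ := h.exists_tail_le hα (mul_pos hε (h.tail_pos x₁))
  refine ⟨max u y, hu1.trans (le_max_left _ _), fun x hx => ?_⟩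
  rcases le_total x₁ x with hle | hle
  · refine le_trans (tail_antitone P R ?_) (hx₁ x hle)
    exact mul_le_mul_of_nonneg_right (le_max_left _ _) (by linarith)
  · refine (tail_antitone P R (?_ : y ≤ _)).trans (hy.trans ?_)
    · nlinarith [le_max_left u y, le_max_right u y]
    · exact mul_le_mul_of_nonneg_left (tail_antitone P R hle) hε.le

end Tail

theorem integral_cond_eq {Ω : Type*} [MeasurableSpace Ω] {P : Measure Ω} {f : Ω → ℝ} (s : Set Ω) :
    ∫ ω, f ω ∂(cond P s) = (P.real s)⁻¹ * ∫ ω in s, f ω ∂P := by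
  rw [ProbabilityTheory.cond, integral_smul_measure, ENNReal.toReal_inv, smul_eq_mul, measureReal_def]

/-! ### Stationary fields -/

section Stationary

variable {Ω : Type*} [MeasurableSpace Ω] {P : Measure Ω} {k d : ℕ}
  {X : (Fin k → ℤ) → Ω → Fin d → ℝ}

theorem StationaryField.identDistrib_comp (h : StationaryField P X) (s : Fin k → ℤ) {n : ℕ}
    (t : Fin n → Fin k → ℤ) :
    IdentDistrib (fun ω i => X (t i) ω) (fun ω i => X (t i - s) ω) P P := by
  have := (h s).comp (u := fun (y : (Fin k → ℤ) → Fin d → ℝ) (i : Fin n) => y (t i - s))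
    (measurable_pi_lambda _ fun i => measurable_pi_apply _)
  simpa [Function.comp_def] using this

theorem StationaryField.integral_shift (h : StationaryField P X) (s : Fin k → ℤ) {n : ℕ}
    (t : Fin n → Fin k → ℤ) {G : (Fin n → Fin d → ℝ) → ℝ} (hG : Measurable G) :
    ∫ ω, G (fun i => X (t i) ω) ∂P = ∫ ω, G (fun i => X (t i - s) ω) ∂P :=
  ((h.identDistrib_comp s t).comp hG).integral_eq

theorem StationaryField.measureReal_eq (h : StationaryField P X) (t : Fin k → ℤ)
    {A : Set (Fin d → ℝ)} (hA : MeasurableSet A) :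
    P.real {ω | X t ω ∈ A} = P.real {ω | X 0 ω ∈ A} := by
  have h1 := (h.identDistrib_comp t (fun _ : Fin 1 => t)).comp (measurable_pi_apply (0 : Fin 1))
  have h2 := h1.measure_mem_eq hA
  simp only [Function.comp_def, sub_self] at h2
  rw [measureReal_def, measureReal_def]
  exact congrArg _ h2

end Stationary

/-! ### Weak convergence from radial tails -/

section Radial

variable {S : Type*} [PseudoMetricSpace S]

/-- The sum freezes the radius at the left end of each layer 1 + iδ < r ≤ 1 + (i+1)δ. Within the
layers the Lipschitz bound costs Lδ; beyond radius 1 + Nδ the sum is 0 and the error is at most C.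
-/
theorem step_approx_pointwise {F : ℝ × S → ℝ} {L C δ : ℝ} (hL : 0 ≤ L) (hδ : 0 < δ)
    (hF : ∀ x y, |F x - F y| ≤ L * dist x y) (hC : ∀ x, |F x| ≤ C) (N : ℕ) (z : ℝ × S)
    (hz : 1 < z.1) :
    |F z - ∑ i ∈ Finset.range N,
      ({w : ℝ × S | 1 + i * δ < w.1}.indicator (fun w => F (1 + i * δ, w.2)) z -
        {w : ℝ × S | 1 + (i + 1 : ℕ) * δ < w.1}.indicator (fun w => F (1 + i * δ, w.2)) z)|
      ≤ L * δ + {w : ℝ × S | 1 + N * δ < w.1}.indicator (fun _ => C) z := by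
  have hC0 : 0 ≤ C := (abs_nonneg _).trans (hC z)
  set T : ℕ → ℝ := fun N => ∑ i ∈ Finset.range N,
      ({w : ℝ × S | 1 + i * δ < w.1}.indicator (fun w => F (1 + i * δ, w.2)) z -
        {w : ℝ × S | 1 + (i + 1 : ℕ) * δ < w.1}.indicator (fun w => F (1 + i * δ, w.2)) z)
    with hT
  have key : ∀ N : ℕ, (1 + N * δ < z.1 → T N = 0) ∧ (z.1 ≤ 1 + N * δ → |F z - T N| ≤ L * δ) := by
    intro N
    induction N with
    | zero => exact ⟨fun _ => by simp [hT], fun h => absurd hz (by simpa using h)⟩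
    | succ N ih =>
      have hs : T (N + 1) = T N + ({w : ℝ × S | 1 + N * δ < w.1}.indicator
          (fun w => F (1 + N * δ, w.2)) z - {w : ℝ × S | 1 + (N + 1 : ℕ) * δ < w.1}.indicator
            (fun w => F (1 + N * δ, w.2)) z) := Finset.sum_range_succ _ _
      have hlt : 1 + (N : ℝ) * δ < 1 + (N + 1 : ℕ) * δ := by push_cast; nlinarith
      constructor
      · intro h
        have h' : 1 + (N : ℝ) * δ < z.1 := hlt.trans h
        rw [hs, ih.1 h', Set.indicator_of_mem (by exact h'), Set.indicator_of_mem (by exact h)]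
        simp
      · intro h
        rw [hs, Set.indicator_of_notMem (s := {w : ℝ × S | 1 + (N + 1 : ℕ) * δ < w.1})
          (by simpa using h)]
        by_cases h' : 1 + (N : ℝ) * δ < z.1
        · rw [ih.1 h', Set.indicator_of_mem (by exact h'), zero_add, sub_zero]
          refine (hF _ _).trans (mul_le_mul_of_nonneg_left ?_ hL)
          rw [Prod.dist_eq]
          refine max_le ?_ (by simp [hδ.le])
          rw [Real.dist_eq, abs_of_nonneg (by linarith)]
          push_cast at h
          linarith
        · rw [Set.indicator_of_notMem (by simpa using h'), sub_zero, add_zero]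
          exact ih.2 (not_lt.1 h')
  by_cases h : 1 + (N : ℝ) * δ < z.1
  · rw [show (∑ i ∈ Finset.range N, _) = T N from rfl, (key N).1 h, sub_zero,
      Set.indicator_of_mem (by exact h)]
    have := hC z
    nlinarith
  · rw [Set.indicator_of_notMem (by simpa using h), add_zero]
    exact (key N).2 (not_lt.1 h)

variable [MeasurableSpace S] [BorelSpace S]

theorem step_approx_integral [SecondCountableTopology S] {F : ℝ × S → ℝ} {L C δ : ℝ} (hL : 0 ≤ L)
    (hδ : 0 < δ) (hF : ∀ x y, |F x - F y| ≤ L * dist x y) (hFc : Continuous F)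
    (hC : ∀ x, |F x| ≤ C) (N : ℕ)
    (ν : Measure (ℝ × S)) [IsProbabilityMeasure ν] (hν : ∀ᵐ z ∂ν, 1 < z.1) :
    |∫ z, F z ∂ν - ∑ i ∈ Finset.range N,
      (∫ z in {w : ℝ × S | 1 + i * δ < w.1}, F (1 + i * δ, z.2) ∂ν -
        ∫ z in {w : ℝ × S | 1 + (i + 1 : ℕ) * δ < w.1}, F (1 + i * δ, z.2) ∂ν)|
      ≤ L * δ + C * ν.real {w : ℝ × S | 1 + N * δ < w.1} := by
  have hm : ∀ u : ℝ, MeasurableSet {w : ℝ × S | u < w.1} := fun u =>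
    measurableSet_lt measurable_const measurable_fst
  have hi : ∀ u : ℝ, Integrable (fun z : ℝ × S => F (u, z.2)) ν := fun u =>
    Integrable.of_bound (hFc.comp (by fun_prop)).measurable.aestronglyMeasurable C
      (ae_of_all _ fun z => hC _)
  have hFi : Integrable F ν :=
    Integrable.of_bound hFc.measurable.aestronglyMeasurable C (ae_of_all _ fun z => hC _)
  simp_rw [← integral_indicator (hm _)]
  have hterm : ∀ i : ℕ, Integrable (fun z =>
      ({w : ℝ × S | 1 + i * δ < w.1}.indicator (fun w => F (1 + i * δ, w.2)) z -
        {w : ℝ × S | 1 + (i + 1 : ℕ) * δ < w.1}.indicator (fun w => F (1 + i * δ, w.2)) z)) ν :=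
    fun i => ((hi _).indicator (hm _)).sub ((hi _).indicator (hm _))
  have h1 : ∑ i ∈ Finset.range N,
      (∫ z, {w : ℝ × S | 1 + i * δ < w.1}.indicator (fun z => F (1 + i * δ, z.2)) z ∂ν -
        ∫ z, {w : ℝ × S | 1 + (i + 1 : ℕ) * δ < w.1}.indicator
          (fun z => F (1 + i * δ, z.2)) z ∂ν) =
      ∫ z, ∑ i ∈ Finset.range N, ({w : ℝ × S | 1 + i * δ < w.1}.indicator
          (fun w => F (1 + i * δ, w.2)) z -
        {w : ℝ × S | 1 + (i + 1 : ℕ) * δ < w.1}.indicator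
          (fun w => F (1 + i * δ, w.2)) z) ∂ν := by
    rw [integral_finsetSum _ fun i _ => hterm i]
    refine Finset.sum_congr rfl fun i _ => ?_
    rw [integral_sub ((hi _).indicator (hm _)) ((hi _).indicator (hm _))]
  rw [h1, ← integral_sub hFi (integrable_finsetSum _ fun i _ => hterm i)]
  refine (abs_integral_le_integral_abs).trans ?_
  have hR : Integrable (fun z => L * δ + {w : ℝ × S | 1 + N * δ < w.1}.indicator
      (fun _ => C) z) ν :=
    (integrable_const _).add ((integrable_const _).indicator (hm _))
  calc _ ≤ ∫ z, (L * δ + {w : ℝ × S | 1 + N * δ < w.1}.indicator (fun _ => C) z) ∂ν := by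
        refine integral_mono_ae (hFi.sub (integrable_finsetSum _ fun i _ => hterm i)).abs hR ?_
        filter_upwards [hν] with z hz
        exact step_approx_pointwise hL hδ hF hC N z hz
    _ = _ := by
        rw [integral_add (integrable_const _) ((integrable_const _).indicator (hm _)),
          integral_indicator_const _ (hm _)]
        simp [mul_comm]

/-- Bounded Lipschitz functions determine weak convergence, and the layer approximation of such a
function is a finite combination of the tail integrals in the hypothesis. The case g = 1 bounds the
mass beyond the last layer. -/
theorem ProbabilityMeasure.tendsto_of_radial_tails [SecondCountableTopology S] {ι : Type*}
    {l : Filter ι} [l.IsCountablyGenerated] {μs : ι → ProbabilityMeasure (ℝ × S)}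
    {μ : ProbabilityMeasure (ℝ × S)}
    (hμs : ∀ᶠ i in l, ∀ᵐ z ∂(μs i : Measure (ℝ × S)), 1 < z.1)
    (hμ : ∀ᵐ z ∂(μ : Measure (ℝ × S)), 1 < z.1)
    (h : ∀ u : ℝ, 1 ≤ u → ∀ g : S →ᵇ ℝ,
      Tendsto (fun i => ∫ z in {z | u < z.1}, g z.2 ∂(μs i : Measure (ℝ × S))) l
        (𝓝 (∫ z in {z | u < z.1}, g z.2 ∂(μ : Measure (ℝ × S))))) :
    Tendsto μs l (𝓝 μ) := by
  rw [tendsto_iff_forall_lipschitz_integral_tendsto]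
  rintro F ⟨B, hB⟩ ⟨L, hL⟩
  have hFc : Continuous F := hL.continuous
  obtain ⟨C, hC0, hC⟩ : ∃ C : ℝ, 0 < C ∧ ∀ x, |F x| ≤ C := by
    rcases isEmpty_or_nonempty (ℝ × S) with h0 | ⟨⟨x₀⟩⟩
    · exact ⟨1, one_pos, fun x => (h0.false x).elim⟩
    · refine ⟨|F x₀| + |B| + 1, by positivity, fun x => ?_⟩
      have h1 := hB x x₀
      rw [Real.dist_eq] at h1
      have h2 := abs_sub_abs_le_abs_sub (F x) (F x₀)
      have h3 := le_abs_self B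
      linarith
  have hF : ∀ x y, |F x - F y| ≤ L * dist x y := fun x y => by
    simpa [Real.dist_eq] using hL.dist_le_mul x y
  refine tendsto_of_approx fun η hη => ?_
  -- Half of η pays for the layer width; the tail beyond the N-th layer pays the other half. `L + 1`
  -- avoids division by zero.
  set δ : ℝ := η / (2 * (L + 1)) with hδdef
  have hLpos : (0 : ℝ) < L + 1 := by positivity
  have hδ : 0 < δ := by positivity
  have hLδ : L * δ ≤ η / 2 := by
    rw [hδdef, mul_div_assoc', div_le_div_iff₀ (by positivity) (by positivity)]
    nlinarith [L.coe_nonneg]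
  have htail : Tendsto (fun N : ℕ => (μ : Measure (ℝ × S)).real {w | 1 + N * δ < w.1}) atTop
      (𝓝 0) := by
    have h1 : Tendsto (fun N : ℕ => (μ : Measure (ℝ × S)) {w | 1 + N * δ < w.1}) atTop
        (𝓝 ((μ : Measure (ℝ × S)) (⋂ N : ℕ, {w : ℝ × S | 1 + N * δ < w.1}))) := by
      refine tendsto_measure_iInter_atTop (fun N =>
        (measurableSet_lt measurable_const measurable_fst).nullMeasurableSet) ?_
        ⟨0, measure_ne_top _ _⟩
      intro m n hmn w hw
      have : (m : ℝ) ≤ n := by exact_mod_cast hmn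
      simp only [Set.mem_ofPred_eq] at hw ⊢
      nlinarith
    have h2 : (⋂ N : ℕ, {w : ℝ × S | 1 + N * δ < w.1}) = ∅ := by
      refine Set.eq_empty_iff_forall_notMem.2 fun w hw => ?_
      obtain ⟨N, hN⟩ := exists_nat_gt ((w.1 - 1) / δ)
      rw [div_lt_iff₀ hδ] at hN
      have := Set.mem_iInter.1 hw N
      simp only [Set.mem_ofPred_eq] at this
      linarith
    rw [h2, measure_empty] at h1
    exact (ENNReal.tendsto_toReal ENNReal.zero_ne_top).comp h1
  obtain ⟨N, hN⟩ := (htail.eventually_lt_const (show 0 < η / (2 * C) by positivity)).exists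
  have hr : (1 : ℝ) ≤ 1 + N * δ := by nlinarith [(Nat.cast_nonneg N : (0 : ℝ) ≤ N)]
  have hmass : Tendsto (fun i => (μs i : Measure (ℝ × S)).real {w | 1 + N * δ < w.1}) l
      (𝓝 ((μ : Measure (ℝ × S)).real {w | 1 + N * δ < w.1})) := by
    simpa using h _ hr (BoundedContinuousFunction.const S 1)
  let g : ℕ → S →ᵇ ℝ := fun i => BoundedContinuousFunction.ofNormedAddCommGroup
    (fun s => F (1 + i * δ, s)) (hFc.comp (by fun_prop)) C fun s => hC _
  have hbound : ∀ x : ℝ, x < η / (2 * C) → L * δ + C * x ≤ η := fun x hx => by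
    rw [lt_div_iff₀ (by positivity)] at hx
    linarith
  refine ⟨_, _, tendsto_finsetSum (Finset.range N) fun i _ =>
    (h (1 + i * δ) ?_ (g i)).sub (h (1 + (i + 1 : ℕ) * δ) ?_ (g i)), ?_, ?_⟩
  · nlinarith [(Nat.cast_nonneg i : (0 : ℝ) ≤ i)]
  · nlinarith [(Nat.cast_nonneg (i + 1) : (0 : ℝ) ≤ (i + 1 : ℕ))]
  · filter_upwards [hμs, hmass.eventually_lt_const hN] with i hi hiN
    exact (step_approx_integral L.coe_nonneg hδ hF hFc hC N _ hi).trans (hbound _ hiN)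
  · exact (step_approx_integral L.coe_nonneg hδ hF hFc hC N _ hμ).trans (hbound _ hN)

end Radial

/-! ### The Pareto law -/

theorem paretoMeasure_real_Ioi {α : ℝ} (hα : 0 < α) {y : ℝ} (hy : 1 ≤ y) :
    (paretoMeasure 1 α).real (Set.Ioi y) = y ^ (-α) := by
  have hy0 : 0 < y := by linarith
  rw [paretoMeasure, measureReal_def, withDensity_apply _ measurableSet_Ioi,
    setLIntegral_congr_fun measurableSet_Ioi
      (fun x (hx : y < x) => paretoPDF_of_le (hy.trans hx.le)),
    ← integral_eq_lintegral_of_nonneg_ae]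
  · rw [integral_const_mul, integral_Ioi_rpow_of_lt (by linarith) hy0]
    have : -(α + 1) + 1 = -α := by ring
    rw [this, Real.one_rpow]
    field_simp
  · refine (ae_restrict_iff' measurableSet_Ioi).2 (ae_of_all _ fun x (hx : y < x) => ?_)
    have : 0 < x := hy0.trans hx
    simp only [Pi.zero_apply]
    positivity
  · exact ((measurable_id.pow_const _).const_mul _).aestronglyMeasurable

theorem paretoMeasure_ae_gt {α : ℝ} (hα : 0 < α) : ∀ᵐ r ∂(paretoMeasure 1 α), 1 < r := by
  have := isProbabilityMeasure_paretoMeasure one_pos hα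
  have h1 := paretoMeasure_real_Ioi hα le_rfl
  rw [Real.one_rpow] at h1
  replace h1 := h1.trans (probReal_univ (μ := paretoMeasure 1 α)).symm
  have h2 := (measureReal_eq_measureReal_iff (measure_ne_top _ _) (measure_ne_top _ _)).1 h1
  have h3 := (ae_eq_univ_iff_measure_eq measurableSet_Ioi.nullMeasurableSet).2 h2
  filter_upwards [eventuallyEq_univ.1 h3] with r hr using hr

/-- The radial part of a regularly varying variable and an angular part converging in law
conditionally on a high radial threshold converge jointly, with an independent Pareto radius. -/
theorem RegularlyVaryingVariable.tendsto_radial_angular {Ω Ω' S : Type*} [MeasurableSpace Ω]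
    [MeasurableSpace Ω'] {P : Measure Ω} [IsProbabilityMeasure P] {Q : Measure Ω'}
    [IsProbabilityMeasure Q] [PseudoMetricSpace S] [MeasurableSpace S] [BorelSpace S]
    [SecondCountableTopology S] {R : Ω → ℝ} {α : ℝ}
    (hR : RegularlyVaryingVariable P R α) (hRm : Measurable R) (hα : 0 < α)
    {A : Ω → S} (hA : Measurable A) {B : Ω' → S} (hB : Measurable B)
    (h : ∀ g : S →ᵇ ℝ, Tendsto (fun x => ∫ ω, g (A ω) ∂(cond P {ω | x < R ω})) atTop
      (𝓝 (∫ ω, g (B ω) ∂Q))) (F : ℝ × S →ᵇ ℝ) :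
    Tendsto (fun x => ∫ ω, F (x⁻¹ * R ω, A ω) ∂(cond P {ω | x < R ω})) atTop
      (𝓝 (∫ z, F (z.1, B z.2) ∂((paretoMeasure 1 α).prod Q))) := by
  have hpar := isProbabilityMeasure_paretoMeasure one_pos hα
  have hcond := hR.isProbabilityMeasure_cond
  have hm1 : ∀ x : ℝ, Measurable fun ω => (x⁻¹ * R ω, A ω) := fun x =>
    (hRm.const_mul _).prodMk hA
  have hm2 : Measurable fun z : ℝ × Ω' => (z.1, B z.2) :=
    measurable_fst.prodMk (hB.comp measurable_snd)
  let μs : ℝ → ProbabilityMeasure (ℝ × S) := fun x =>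
    ⟨(cond P {ω | x < R ω}).map fun ω => (x⁻¹ * R ω, A ω),
      Measure.isProbabilityMeasure_map (hm1 x).aemeasurable⟩
  let μ : ProbabilityMeasure (ℝ × S) :=
    ⟨((paretoMeasure 1 α).prod Q).map fun z => (z.1, B z.2),
      Measure.isProbabilityMeasure_map hm2.aemeasurable⟩
  have hlt : ∀ u : ℝ, MeasurableSet {z : ℝ × S | u < z.1} := fun u =>
    measurableSet_lt measurable_const measurable_fst
  have hset : ∀ x : ℝ, MeasurableSet {ω | x < R ω} := fun x =>
    measurableSet_lt measurable_const hRm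
  have main : Tendsto μs atTop (𝓝 μ) := by
    refine ProbabilityMeasure.tendsto_of_radial_tails ?_ ?_ ?_
    · filter_upwards [eventually_gt_atTop 0] with x hx
      refine (ae_map_iff (hm1 x).aemeasurable (hlt 1)).2 ?_
      refine ae_cond_of_forall_mem (hset x) fun ω (hω : x < R ω) => ?_
      rwa [inv_mul_eq_div, one_lt_div hx]
    · refine (ae_map_iff hm2.aemeasurable (hlt 1)).2 ?_
      exact Measure.quasiMeasurePreserving_fst.ae (paretoMeasure_ae_gt hα)
    · intro u hu g
      have hu0 : 0 < u := by linarith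
      have hgm : Measurable g := g.continuous.measurable
      have e2 : ∫ z in {z | u < z.1}, g z.2 ∂(μ : Measure (ℝ × S)) =
          u ^ (-α) * ∫ ω, g (B ω) ∂Q := by
        have : ∫ z in {z | u < z.1}, g z.2 ∂(μ : Measure (ℝ × S)) =
            ∫ z in Set.Ioi u ×ˢ Set.univ, (1 : ℝ) * g (B z.2) ∂((paretoMeasure 1 α).prod Q) := by
          change ∫ z in {z : ℝ × S | u < z.1}, g z.2 ∂(((paretoMeasure 1 α).prod Q).map _) = _
          rw [setIntegral_map (f := fun z : ℝ × S => g z.2) (hlt u)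
            (hgm.comp measurable_snd).aestronglyMeasurable hm2.aemeasurable]
          simp only [one_mul]
          congr 2
          ext z
          simp
        rw [this, setIntegral_prod_mul (μ := paretoMeasure 1 α) (ν := Q) (fun _ => (1 : ℝ))
          (fun ω => g (B ω))]
        simp [paretoMeasure_real_Ioi hα hu]
      -- Since u ≥ 1, conditioning on R > x and then restricting to R > ux is, up to the ratio of
      -- tails, conditioning on R > ux.
      have e1 : ∀ᶠ x : ℝ in atTop,
          (P.real {ω | u * x < R ω} / P.real {ω | x < R ω}) *
            ∫ ω, g (A ω) ∂(cond P {ω | u * x < R ω}) =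
          ∫ z in {z | u < z.1}, g z.2 ∂(μs x : Measure (ℝ × S)) := by
        filter_upwards [eventually_gt_atTop 0] with x hx
        change _ = ∫ z in {z : ℝ × S | u < z.1}, g z.2 ∂((cond P {ω | x < R ω}).map _)
        rw [setIntegral_map (f := fun z : ℝ × S => g z.2) (hlt u)
            (hgm.comp measurable_snd).aestronglyMeasurable (hm1 x).aemeasurable]
        have hpre : (fun ω => (x⁻¹ * R ω, A ω)) ⁻¹' {z | u < z.1} = {ω | u * x < R ω} := by
          ext ω
          simp [inv_mul_eq_div, lt_div_iff₀ hx]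
        have hsub : {ω | u * x < R ω} ⊆ {ω | x < R ω} := fun ω (hω : u * x < R ω) =>
          lt_of_le_of_lt (by nlinarith) hω
        rw [hpre, integral_cond_eq, ProbabilityTheory.cond, Measure.restrict_smul,
          Measure.restrict_restrict (hset _), Set.inter_eq_left.2 hsub,
          integral_smul_measure, ENNReal.toReal_inv, ← measureReal_def, smul_eq_mul]
        have := (hR.tail_pos (u * x)).ne'
        field_simp
      rw [e2]
      refine Tendsto.congr' e1 ((hR.tendsto_ratio u hu0).mul ((h g).comp ?_))
      exact tendsto_id.const_mul_atTop hu0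
  have := ProbabilityMeasure.tendsto_iff_forall_integral_tendsto.1 main F
  refine (this.congr fun x => ?_).trans_eq ?_
  · exact integral_map (hm1 x).aemeasurable F.continuous.measurable.aestronglyMeasurable
  · congr 1
    exact integral_map hm2.aemeasurable F.continuous.measurable.aestronglyMeasurable

/-! ### Test functions on the punctured extended space -/

section Extended

variable {J : Type*}

theorem isOpenEmbedding_coe_ereal_pi [Finite J] :
    IsOpenEmbedding (fun (z : J → ℝ) j => (z j : EReal)) :=
  IsOpenEmbedding.piMap fun _ => EReal.isOpenEmbedding_coe

/-- Off the range, the extension vanishes on a neighbourhood: the image of the support is compact,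
hence closed. -/
theorem Topology.IsOpenEmbedding.continuous_extend_zero {X Y : Type*} [TopologicalSpace X]
    [TopologicalSpace Y] [T2Space Y] {e : X → Y} (he : IsOpenEmbedding e) {f : X → ℝ}
    (hf : Continuous f) (hc : HasCompactSupport f) : Continuous (Function.extend e f 0) := by
  rw [continuous_iff_continuousAt]
  intro y
  by_cases hy : y ∈ Set.range e
  · obtain ⟨x, rfl⟩ := hy
    rw [← he.continuousAt_iff, Function.extend_comp he.injective]
    exact hf.continuousAt
  · have hcl : IsClosed (e '' tsupport f) := (hc.isCompact.image he.continuous).isClosed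
    have hmem : y ∈ (e '' tsupport f)ᶜ := fun h => hy (Set.image_subset_range _ _ h)
    have hev : Function.extend e f 0 =ᶠ[𝓝 y] fun _ => 0 := by
      filter_upwards [hcl.isOpen_compl.mem_nhds hmem] with w hw
      by_cases hwr : w ∈ Set.range e
      · obtain ⟨x, rfl⟩ := hwr
        rw [he.injective.extend_apply]
        by_contra h
        exact hw ⟨x, subset_tsupport f h, rfl⟩
      · rw [Function.extend_apply' _ _ _ hwr]
        rfl
    exact continuousAt_const.congr hev.symm

instance PuncturedExtended.locallyCompactSpace [Finite J] :
    LocallyCompactSpace (PuncturedExtended J) :=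
  (isOpen_ne (x := (0 : J → EReal))).locallyCompactSpace

/-- The full space [-∞, ∞]^J is compact, so the complement of an open box about 0 is compact:
compact support in the punctured space only asks for vanishing near the origin. -/
theorem hasCompactSupport_comp_val [Fintype J] {f : (J → EReal) → ℝ} {ε : ℝ} (hε : 0 < ε)
    (h0 : ∀ z : J → ℝ, ‖z‖ < ε → f (fun j => (z j : EReal)) = 0) :
    HasCompactSupport fun y : PuncturedExtended J => f y.1 := by
  set U : Set (J → EReal) := Set.univ.pi fun _ => Set.Ioo ((-ε : ℝ) : EReal) (ε : ℝ) with hU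
  have hUo : IsOpen U := isOpen_set_pi Set.finite_univ fun _ _ => isOpen_Ioo
  have hU0 : (0 : J → EReal) ∈ U := fun j _ => by
    constructor
    · exact EReal.coe_lt_coe_iff.2 (neg_lt_zero.2 hε)
    · exact EReal.coe_lt_coe_iff.2 hε
  have hfU : ∀ y ∈ U, f y = 0 := fun y hy => by
    have hy' : ∀ j, ∃ r : ℝ, (r : EReal) = y j := fun j => by
      have := hy j (Set.mem_univ j)
      exact ⟨(y j).toReal, EReal.coe_toReal (this.2.trans (EReal.coe_lt_top _)).ne
        ((EReal.bot_lt_coe _).trans this.1).ne'⟩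
    choose r hr using hy'
    have hyr : y = fun j => (r j : EReal) := funext fun j => (hr j).symm
    rw [hyr]
    refine h0 r ((pi_norm_lt_iff hε).2 fun j => ?_)
    have := hy j (Set.mem_univ j)
    rw [← hr j] at this
    rw [Real.norm_eq_abs, abs_lt]
    exact ⟨by exact_mod_cast this.1, by exact_mod_cast this.2⟩
  refine HasCompactSupport.intro (K := Subtype.val ⁻¹' Uᶜ) ?_ fun y hy => hfU _ (by simpa using hy)
  have : Subtype.val '' (Subtype.val ⁻¹' Uᶜ : Set (PuncturedExtended J)) = Uᶜ := by
    ext y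
    exact ⟨fun ⟨w, hw, hwy⟩ => hwy ▸ hw, fun hy => ⟨⟨y, fun h => hy (h ▸ hU0)⟩, hy, rfl⟩⟩
  rw [Subtype.isCompact_iff, this]
  exact hUo.isClosed_compl.isCompact

variable {Ω : Type*} [MeasurableSpace Ω] (P : Measure Ω) {Z : Ω → J → ℝ}

theorem measurable_scaled_coe (hZ : Measurable Z) (x : ℝ) :
    Measurable fun ω j => ((x⁻¹ * Z ω j : ℝ) : EReal) :=
  measurable_pi_lambda _ fun j => measurable_coe_real_ereal.comp
    (((measurable_pi_apply j).comp hZ).const_mul _)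

variable [Fintype J]

theorem integral_scaledLaw (hZ : Measurable Z) (x : ℝ) {f : (J → EReal) → ℝ} (hf : Continuous f)
    (h0 : f 0 = 0) :
    ∫ y, f y.1 ∂(scaledLaw P Z x) = ∫ ω, f (fun j => ((x⁻¹ * Z ω j : ℝ) : EReal)) ∂P := by
  have hs : MeasurableSet {y : J → EReal | y ≠ 0} := (measurableSet_singleton _).compl
  have h1 : ∫ y, f y.1 ∂(scaledLaw P Z x) = _ := integral_subtype_comap hs f
  rw [h1, setIntegral_eq_integral_of_forall_compl_eq_zero, integral_map
    (measurable_scaled_coe hZ x).aemeasurable hf.measurable.aestronglyMeasurable]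
  intro y hy
  have : y = 0 := by simpa using hy
  rw [this, h0]

instance isFiniteMeasure_scaledLaw [IsFiniteMeasure P] (x : ℝ) :
    IsFiniteMeasure (scaledLaw P Z x) := by
  refine ⟨lt_of_le_of_lt (Measure.comap_apply_le _ _ nullMeasurableSet_univ) ?_⟩
  exact measure_lt_top _ _

/-- A compactly supported test function on the punctured extended space restricts to a bounded
continuous function on `ℝ^J` vanishing near the origin. -/
theorem exists_boundedContinuous_of_hasCompactSupport {f : PuncturedExtended J → ℝ}
    (hf : Continuous f) (hc : HasCompactSupport f) :
    ∃ (G : (J → ℝ) →ᵇ ℝ) (ε : ℝ), 0 < ε ∧ (∀ z, ‖z‖ < ε → G z = 0) ∧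
      ∀ {Ω : Type _} [MeasurableSpace Ω] (P : Measure Ω) {Z : Ω → J → ℝ}, Measurable Z →
        ∀ x : ℝ, ∫ y, f y ∂(scaledLaw P Z x) = ∫ ω, G (x⁻¹ • Z ω) ∂P := by
  set g : (J → EReal) → ℝ := Function.extend Subtype.val f 0 with hg
  have hgc : Continuous g := (isOpen_ne (x := (0 : J → EReal))).isOpenEmbedding_subtypeVal
    |>.continuous_extend_zero hf hc
  have hgf : ∀ y : PuncturedExtended J, g y.1 = f y := Subtype.val_injective.extend_apply f 0
  have hg0 : g 0 = 0 := Function.extend_apply' _ _ _ fun ⟨y, hy⟩ => y.2 hy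
  have hcoe : Continuous fun (z : J → ℝ) j => (z j : EReal) :=
    isOpenEmbedding_coe_ereal_pi.continuous
  obtain ⟨C, hC⟩ := isCompact_univ.exists_bound_of_continuousOn hgc.continuousOn
  have hK : IsClosed (Subtype.val '' tsupport f) :=
    (hc.isCompact.image continuous_subtype_val).isClosed
  have hnhds : (fun (z : J → ℝ) j => (z j : EReal)) ⁻¹' (Subtype.val '' tsupport f)ᶜ ∈
      𝓝 (0 : J → ℝ) := by
    refine (hK.isOpen_compl.preimage hcoe).mem_nhds ?_
    rintro ⟨y, -, hy⟩
    exact y.2 (hy.trans (by ext; simp))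
  obtain ⟨ε, hε, hball⟩ := Metric.mem_nhds_iff.1 hnhds
  refine ⟨BoundedContinuousFunction.ofNormedAddCommGroup
    (fun z => g fun j => (z j : EReal)) (hgc.comp hcoe) C fun z => hC _ (Set.mem_univ _), ε, hε,
    fun z hz => ?_, fun {Ω} _ P Z hZ x => ?_⟩
  · have h1 : (fun j => (z j : EReal)) ∉ Subtype.val '' tsupport f :=
      hball (by simpa using hz)
    change g _ = 0
    by_cases hz0 : (fun j => (z j : EReal)) = 0
    · rw [hz0, hg0]
    · rw [hgf ⟨_, hz0⟩]
      by_contra h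
      exact h1 ⟨⟨_, hz0⟩, subset_tsupport f h, rfl⟩
  · simp_rw [← hgf]
    rw [integral_scaledLaw P hZ x hgc hg0]
    rfl

/-- A continuous function on the extended space which vanishes near the origin is an admissible
test function. -/
theorem exists_testFunction {g : (J → EReal) → ℝ} (hg : Continuous g) {ε : ℝ}
    (hε : 0 < ε) (h0 : ∀ z : J → ℝ, ‖z‖ < ε → g (fun j => (z j : EReal)) = 0) :
    ∃ f : C(PuncturedExtended J, ℝ), HasCompactSupport f ∧
      ∀ {Ω : Type _} [MeasurableSpace Ω] (P : Measure Ω) {Z : Ω → J → ℝ}, Measurable Z →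
        ∀ x : ℝ, ∫ y, f y ∂(scaledLaw P Z x) = ∫ ω, g (fun j => ((x⁻¹ * Z ω j : ℝ) : EReal)) ∂P := by
  refine ⟨⟨fun y => g y.1, hg.comp continuous_subtype_val⟩, hasCompactSupport_comp_val hε h0,
    fun P Z hZ x => integral_scaledLaw P hZ x hg ?_⟩
  have := h0 0 (by simpa using hε)
  simpa [Pi.zero_def] using this

theorem exists_testFunction_of_hasCompactSupport {G : (J → ℝ) → ℝ} (hG : Continuous G)
    (hc : HasCompactSupport G) {ε : ℝ} (hε : 0 < ε) (h0 : ∀ z : J → ℝ, ‖z‖ < ε → G z = 0) :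
    ∃ f : C(PuncturedExtended J, ℝ), HasCompactSupport f ∧
      ∀ {Ω : Type _} [MeasurableSpace Ω] (P : Measure Ω) {Z : Ω → J → ℝ}, Measurable Z →
        ∀ x : ℝ, ∫ y, f y ∂(scaledLaw P Z x) = ∫ ω, G (x⁻¹ • Z ω) ∂P := by
  have he := isOpenEmbedding_coe_ereal_pi (J := J)
  have hval : ∀ z : J → ℝ, Function.extend (fun (z : J → ℝ) j => (z j : EReal)) G 0
      (fun j => (z j : EReal)) = G z := he.injective.extend_apply G 0
  obtain ⟨f, hf, hfi⟩ := exists_testFunction (he.continuous_extend_zero hG hc) hε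
    fun z hz => (hval z).trans (h0 z hz)
  refine ⟨f, hf, fun P Z hZ x => (hfi P hZ x).trans (integral_congr_ae (ae_of_all _ fun ω => ?_))⟩
  exact hval (x⁻¹ • Z ω)

/-- A function of some of the coordinates which is constant equal to `1` outside a compact set is
an admissible test function. -/
theorem exists_testFunction_of_comp {K : Type*} [Fintype K] (i : K → J) {φ : (K → ℝ) → ℝ}
    (hφ : Continuous φ) (hc : HasCompactSupport fun z => φ z - 1) {ε : ℝ} (hε : 0 < ε)
    (h0 : ∀ z : K → ℝ, ‖z‖ < ε → φ z = 0) :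
    ∃ f : C(PuncturedExtended J, ℝ), HasCompactSupport f ∧
      ∀ {Ω : Type _} [MeasurableSpace Ω] (P : Measure Ω) {Z : Ω → J → ℝ}, Measurable Z →
        ∀ x : ℝ, ∫ y, f y ∂(scaledLaw P Z x) = ∫ ω, φ (fun j => x⁻¹ * Z ω (i j)) ∂P := by
  have he := isOpenEmbedding_coe_ereal_pi (J := K)
  have hval : ∀ z : K → ℝ, Function.extend (fun (z : K → ℝ) j => (z j : EReal))
      (fun z => φ z - 1) (0 : (K → EReal) → ℝ) (fun j => (z j : EReal)) = φ z - 1 :=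
    he.injective.extend_apply _ _
  have hext := he.continuous_extend_zero (hφ.sub continuous_const) hc
  -- Extending φ - 1 by zero and adding 1 back gives the value 1 where a selected coordinate is
  -- infinite, so the test function stays continuous there.
  obtain ⟨f, hf, hfi⟩ := exists_testFunction (J := J)
    (g := fun y => Function.extend (fun (z : K → ℝ) j => (z j : EReal))
      (fun z => φ z - 1) (0 : (K → EReal) → ℝ) (fun j => y (i j)) + 1)
    ((hext.comp (continuous_pi fun j => continuous_apply (i j))).add continuous_const) hε fun z hz => by
      rw [hval fun j => z (i j), h0]
      · ring
      · refine lt_of_le_of_lt ?_ hz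
        exact (pi_norm_le_iff_of_nonneg (norm_nonneg _)).2 fun j => norm_le_pi_norm z (i j)
  refine ⟨f, hf, fun P Z hZ x => (hfi P hZ x).trans (integral_congr_ae (ae_of_all _ fun ω => ?_))⟩
  simp only [hval fun j => x⁻¹ * Z ω (i j), sub_add_cancel]

end Extended

/-! ### From the angular limit to the tail field -/

section TailField

variable {Ω Ω' : Type*} [MeasurableSpace Ω] [MeasurableSpace Ω'] {P : Measure Ω}
  {Q : Measure Ω'} [IsProbabilityMeasure Q] {k d : ℕ}
  {p : Seminorm ℝ (Fin d → ℝ)} {X : (Fin k → ℤ) → Ω → Fin d → ℝ}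
  {Θ : (Fin k → ℤ) → Ω' → Fin d → ℝ} {α : ℝ}

theorem Seminorm.measurable_comp (p : Seminorm ℝ (Fin d → ℝ)) {Y : Ω → Fin d → ℝ}
    (hY : Measurable Y) : Measurable fun ω => p (Y ω) :=
  p.continuous_of_finiteDimensional'.measurable.comp hY

/-- The bounded function min(|p - 1|, 1) of the normalised X(0) is identically 0 on R > x > 0, so
its integral against the limit law is 0. -/
theorem AngularLimit.ae_eq_one (hX : ∀ t, Measurable (X t))
    (hΘ : ∀ t, Measurable (Θ t)) (h : AngularLimit p P X Q Θ) :
    ∀ᵐ ω ∂Q, p (Θ 0 ω) = 1 := by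
  have hpc := p.continuous_of_finiteDimensional'
  have hRm : Measurable fun ω => p (X 0 ω) := p.measurable_comp (hX 0)
  let f : (Fin 1 → Fin d → ℝ) →ᵇ ℝ := BoundedContinuousFunction.ofNormedAddCommGroup
    (fun z => min |p (z 0) - 1| 1) (by fun_prop) 1 fun z => by
      rw [Real.norm_eq_abs, abs_of_nonneg (by positivity)]
      exact min_le_right _ _
  have h1 : Tendsto (fun _ : ℝ => (0 : ℝ)) atTop (𝓝 (∫ ω, f (fun _ => Θ 0 ω) ∂Q)) := by
    refine Tendsto.congr' ?_ (h 1 (fun _ => 0) f)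
    filter_upwards [eventually_gt_atTop 0] with x hx
    rw [← integral_zero Ω ℝ (μ := cond P {ω | x < p (X 0 ω)})]
    refine integral_congr_ae (ae_cond_of_forall_mem (measurableSet_lt measurable_const hRm)
      fun ω (hω : x < p (X 0 ω)) => ?_)
    have hpos : 0 < p (X 0 ω) := hx.trans hω
    change min |p ((p (X 0 ω))⁻¹ • X 0 ω) - 1| 1 = 0
    rw [map_smul_eq_mul, norm_inv, Real.norm_of_nonneg hpos.le, inv_mul_cancel₀ hpos.ne']
    simp
  have h2 : ∫ ω, f (fun _ => Θ 0 ω) ∂Q = 0 := tendsto_nhds_unique h1 tendsto_const_nhds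
  have hm : Measurable fun ω => f fun _ => Θ 0 ω :=
    f.continuous.measurable.comp (measurable_pi_lambda _ fun _ => hΘ 0)
  rw [integral_eq_zero_iff_of_nonneg (fun ω => by
      change 0 ≤ min |p (Θ 0 ω) - 1| 1
      positivity)
    (Integrable.of_bound hm.aestronglyMeasurable ‖f‖ (ae_of_all _ fun ω => f.norm_coe_le_norm _))]
    at h2
  filter_upwards [h2] with ω hω
  have hω' : min |p (Θ 0 ω) - 1| 1 = 0 := hω
  rcases min_choice |p (Θ 0 ω) - 1| 1 with h3 | h3
  · rw [h3, abs_eq_zero] at hω'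
    linarith
  · rw [h3] at hω'
    exact absurd hω' one_ne_zero

variable [IsProbabilityMeasure P]

/-- Continuous mapping (r, a) ↦ r • a applied to the joint limit of radius and angle, as x⁻¹X =
(R/x) · (X/R). -/
theorem AngularLimit.fddTendsto_pareto_smul (hX : ∀ t, Measurable (X t)) (hα : 0 < α)
    (hrv : RegularlyVaryingVariable P (fun ω => p (X 0 ω)) α)
    (hΘ : ∀ t, Measurable (Θ t)) (h : AngularLimit p P X Q Θ) :
    FddTendsto (fun x => cond P {ω | x < p (X 0 ω)}) (fun x t ω => x⁻¹ • X t ω)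
      ((paretoMeasure 1 α).prod Q) (fun t z => z.1 • Θ t z.2) := by
  intro n t f
  have hRm : Measurable fun ω => p (X 0 ω) := p.measurable_comp (hX 0)
  have hA : Measurable fun ω i => (p (X 0 ω))⁻¹ • X (t i) ω :=
    measurable_pi_lambda _ fun i => hRm.inv.smul (hX _)
  have hB : Measurable fun ω i => Θ (t i) ω := measurable_pi_lambda _ fun i => hΘ _
  have key := hrv.tendsto_radial_angular hRm hα hA hB (h n t)
    (f.compContinuous ⟨fun z => z.1 • z.2, by fun_prop⟩)
  refine Tendsto.congr' ?_ key
  filter_upwards [eventually_gt_atTop 0] with x hx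
  refine integral_congr_ae (ae_cond_of_forall_mem (measurableSet_lt measurable_const hRm)
    fun ω (hω : x < p (X 0 ω)) => ?_)
  have hne : p (X 0 ω) ≠ 0 := (hx.trans hω).ne'
  have : (fun i => x⁻¹ • X (t i) ω) =
      (x⁻¹ * p (X 0 ω)) • fun i => (p (X 0 ω))⁻¹ • X (t i) ω := by
    ext i j
    simp only [Pi.smul_apply, smul_eq_mul]
    field_simp
  exact (congrArg f this).symm

theorem AngularLimit.isTailField (hX : ∀ t, Measurable (X t)) (hα : 0 < α)
    (hrv : RegularlyVaryingVariable P (fun ω => p (X 0 ω)) α)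
    (hΘ : ∀ t, Measurable (Θ t)) (h : AngularLimit p P X Q Θ) :
    IsTailField p P X α ((paretoMeasure 1 α).prod Q) (fun t z => z.1 • Θ t z.2) := by
  have hpar := isProbabilityMeasure_paretoMeasure one_pos hα
  refine ⟨inferInstance, fun t => measurable_fst.smul ((hΘ t).comp measurable_snd),
    h.fddTendsto_pareto_smul hX hα hrv hΘ, fun y hy => ?_⟩
  have h1 : ∀ᵐ z ∂((paretoMeasure 1 α).prod Q), p (Θ 0 z.2) = 1 :=
    Measure.quasiMeasurePreserving_snd.ae (h.ae_eq_one hX hΘ)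
  have h2 : ∀ᵐ z ∂((paretoMeasure 1 α).prod Q), 1 < z.1 :=
    Measure.quasiMeasurePreserving_fst.ae (paretoMeasure_ae_gt hα)
  have h3 : {z : ℝ × Ω' | y < p (z.1 • Θ 0 z.2)} =ᵐ[(paretoMeasure 1 α).prod Q]
      Set.Ioi y ×ˢ Set.univ := by
    filter_upwards [h1, h2] with z hz1 hz2
    refine propext ?_
    change y < p (z.1 • Θ 0 z.2) ↔ z ∈ Set.Ioi y ×ˢ Set.univ
    rw [map_smul_eq_mul, hz1, mul_one, Real.norm_of_nonneg (by linarith)]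
    simp
  rw [measureReal_congr h3, measureReal_prod_prod, probReal_univ, mul_one,
    paretoMeasure_real_Ioi hα hy]

theorem AngularLimit.isSpectralField {Ω' : Type} [MeasurableSpace Ω'] {Q : Measure Ω'}
    [IsProbabilityMeasure Q] {Θ : (Fin k → ℤ) → Ω' → Fin d → ℝ}
    (hX : ∀ t, Measurable (X t)) (hα : 0 < α)
    (hrv : RegularlyVaryingVariable P (fun ω => p (X 0 ω)) α)
    (hΘ : ∀ t, Measurable (Θ t)) (h : AngularLimit p P X Q Θ) :
    IsSpectralField p P X α Q Θ := by
  have hpar := isProbabilityMeasure_paretoMeasure one_pos hα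
  refine ⟨ℝ × Ω', inferInstance, (paretoMeasure 1 α).prod Q, fun t z => z.1 • Θ t z.2,
    h.isTailField hX hα hrv hΘ, ?_⟩
  have hΘm : Measurable fun ω t => Θ t ω := measurable_pi_lambda _ hΘ
  have h1 : ∀ᵐ z ∂((paretoMeasure 1 α).prod Q), p (Θ 0 z.2) = 1 :=
    Measure.quasiMeasurePreserving_snd.ae (h.ae_eq_one hX hΘ)
  have h2 : ∀ᵐ z ∂((paretoMeasure 1 α).prod Q), 1 < z.1 :=
    Measure.quasiMeasurePreserving_fst.ae (paretoMeasure_ae_gt hα)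
  have h3 : (fun z : ℝ × Ω' => fun t => Θ t z.2) =ᵐ[(paretoMeasure 1 α).prod Q]
      fun z t => (p (z.1 • Θ 0 z.2))⁻¹ • z.1 • Θ t z.2 := by
    filter_upwards [h1, h2] with z hz1 hz2
    have hz : z.1 ≠ 0 := by linarith
    funext t
    rw [map_smul_eq_mul, hz1, mul_one, Real.norm_of_nonneg (by linarith), inv_smul_smul₀ hz]
  have h4 : IdentDistrib (fun ω t => Θ t ω) (fun z : ℝ × Ω' => fun t => Θ t z.2) Q
      ((paretoMeasure 1 α).prod Q) := by
    refine ⟨hΘm.aemeasurable, (hΘm.comp measurable_snd).aemeasurable, ?_⟩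
    have : ((paretoMeasure 1 α).prod Q).map Prod.snd = Q := by simp
    conv_lhs => rw [← this]
    rw [Measure.map_map hΘm measurable_snd]
    rfl
  exact h4.trans (IdentDistrib.of_ae_eq (hΘm.comp measurable_snd).aemeasurable h3)

end TailField

/-! ### Existence of vague limits -/

/-- The pointwise limits form a positive linear functional on compactly supported functions; the
Riesz measure represents it. -/
theorem exists_vagueTendsto {S : Type*} [TopologicalSpace S] [T2Space S] [LocallyCompactSpace S]
    [MeasurableSpace S] [BorelSpace S] {ν : ℝ → Measure S} [∀ x, IsFiniteMeasure (ν x)]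
    (h : ∀ f : S → ℝ, Continuous f → HasCompactSupport f →
      ∃ a, Tendsto (fun x => ∫ y, f y ∂(ν x)) atTop (𝓝 a)) :
    ∃ μ : Measure S, IsFiniteMeasureOnCompacts μ ∧ VagueTendsto ν μ := by
  have h' : ∀ f : CompactlySupportedContinuousMap S ℝ,
      ∃ a, Tendsto (fun x => ∫ y, f y ∂(ν x)) atTop (𝓝 a) := fun f =>
    h f f.continuous f.hasCompactSupport
  choose Λ hΛ using h'
  let L : CompactlySupportedContinuousMap S ℝ →ₗ[ℝ] ℝ :=
    { toFun := Λ
      map_add' := fun f g => by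
        refine tendsto_nhds_unique (hΛ (f + g)) (((hΛ f).add (hΛ g)).congr fun x => ?_)
        exact (integral_add f.integrable g.integrable).symm
      map_smul' := fun a f => by
        refine tendsto_nhds_unique (hΛ (a • f)) (((hΛ f).const_mul a).congr fun x => ?_)
        exact (integral_const_mul a _).symm }
  have hL : ∀ f, 0 ≤ f → 0 ≤ L f := fun f hf =>
    ge_of_tendsto' (hΛ f) fun x => integral_nonneg fun y => hf y
  let L' := PositiveLinearMap.mk₀ L hL
  refine ⟨RealRMK.rieszMeasure L', inferInstance, fun f hf hc => ?_⟩
  have h1 : ∫ y, f y ∂(RealRMK.rieszMeasure L') = Λ ⟨⟨f, hf⟩, hc⟩ :=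
    RealRMK.integral_rieszMeasure L' ⟨⟨f, hf⟩, hc⟩
  rw [h1]
  exact hΛ ⟨⟨f, hf⟩, hc⟩

/-! ### Norm tails of stationary fields -/

section NormTails

variable {Ω : Type*} [MeasurableSpace Ω] {P : Measure Ω} {k d : ℕ}
  {p : Seminorm ℝ (Fin d → ℝ)} {X : (Fin k → ℤ) → Ω → Fin d → ℝ} {α : ℝ}

theorem StationaryField.tail_eq (h : StationaryField P X) (t : Fin k → ℤ) (x : ℝ) :
    P.real {ω | x < p (X t ω)} = P.real {ω | x < p (X 0 ω)} :=
  h.measureReal_eq t (A := {v | x < p v})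
    (isOpen_lt continuous_const p.continuous_of_finiteDimensional').measurableSet

variable [IsProbabilityMeasure P]

/-- Union bound over the n coordinates, which share the same norm tail by stationarity. -/
theorem StationaryField.norm_tail_le (h : StationaryField P X) {c : ℝ} (hc : 0 < c)
    (hcp : ∀ v, c * ‖v‖ ≤ p v) {n : ℕ} (t : Fin n → Fin k → ℤ) {r : ℝ} (hr : 0 ≤ r) :
    P.real {ω | r < ‖fun i => X (t i) ω‖} ≤ n * P.real {ω | c * r < p (X 0 ω)} := by
  have hsub : {ω | r < ‖fun i => X (t i) ω‖} ⊆ ⋃ i, {ω | c * r < p (X (t i) ω)} := by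
    intro ω hω
    by_contra hcon
    simp only [Set.mem_iUnion, Set.mem_ofPred_eq, not_exists, not_lt] at hcon
    refine absurd (show r < ‖fun i => X (t i) ω‖ from hω) (not_lt.2 ?_)
    exact (pi_norm_le_iff_of_nonneg hr).2 fun i =>
      le_of_mul_le_mul_left ((hcp _).trans (hcon i)) hc
  calc _ ≤ P.real (⋃ i, {ω | c * r < p (X (t i) ω)}) := measureReal_mono hsub
    _ ≤ ∑ i, P.real {ω | c * r < p (X (t i) ω)} := measureReal_iUnion_fintype_le _
    _ = n * P.real {ω | c * r < p (X 0 ω)} := by simp [h.tail_eq]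

/-- The function `min (max (p v - 1) 0) 1`, separating `p v ≤ 1` from `2 ≤ p v`. -/
def largeValue (p : Seminorm ℝ (Fin d → ℝ)) (v : Fin d → ℝ) : ℝ := min (max (p v - 1) 0) 1

theorem continuous_largeValue : Continuous (largeValue p) := by
  have := p.continuous_of_finiteDimensional'
  unfold largeValue
  fun_prop

theorem largeValue_nonneg (v : Fin d → ℝ) : 0 ≤ largeValue p v :=
  le_min (le_max_right _ _) zero_le_one

theorem largeValue_le_one (v : Fin d → ℝ) : largeValue p v ≤ 1 := min_le_right _ _

theorem largeValue_of_le {v : Fin d → ℝ} (h : p v ≤ 1) : largeValue p v = 0 := by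
  rw [largeValue, max_eq_right (by linarith)]
  simp

theorem largeValue_of_ge {v : Fin d → ℝ} (h : 2 ≤ p v) : largeValue p v = 1 := by
  rw [largeValue, max_eq_left (by linarith), min_eq_right (by linarith)]

/-- A reference test function: as it equals 1 for large arguments, it extends continuously to
infinite points. -/
theorem exists_testFunction_largeValue (hp : ∀ v, p v = 0 → v = 0) {n : ℕ} (i : Fin n) :
    ∃ f : C(PuncturedExtended (Fin n × Fin d), ℝ), HasCompactSupport f ∧
      ∀ {Ω : Type _} [MeasurableSpace Ω] (P : Measure Ω) {Z : Ω → Fin n × Fin d → ℝ},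
        Measurable Z → ∀ x : ℝ,
        ∫ y, f y ∂(scaledLaw P Z x) = ∫ ω, largeValue p (fun j => x⁻¹ * Z ω (i, j)) ∂P := by
  obtain ⟨c, hc, hcp⟩ := p.exists_mul_norm_le hp
  obtain ⟨C, hC, hCp⟩ := p.exists_le_mul_norm
  refine exists_testFunction_of_comp (fun j => (i, j)) continuous_largeValue ?_
    (ε := 1 / C) (by positivity) fun z hz => largeValue_of_le ?_
  · refine HasCompactSupport.intro (isCompact_closedBall 0 (2 / c)) fun v hv => ?_
    rw [largeValue_of_ge, sub_self]
    rw [mem_closedBall_zero_iff, not_le, div_lt_iff₀ hc] at hv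
    linarith [hcp v]
  · rw [lt_div_iff₀ hC] at hz
    linarith [hCp z]

theorem StationaryField.le_integral_largeValue (h : StationaryField P X)
    (hX : ∀ t, Measurable (X t)) (t : Fin k → ℤ) {x : ℝ} (hx : 0 < x) :
    P.real {ω | 2 * x < p (X 0 ω)} ≤ ∫ ω, largeValue p (x⁻¹ • X t ω) ∂P := by
  have hset : MeasurableSet {ω | 2 * x < p (X t ω)} :=
    measurableSet_lt measurable_const (p.measurable_comp (hX t))
  rw [← h.tail_eq t, ← integral_indicator_one hset]
  refine integral_mono ((integrable_const _).indicator hset)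
    (Integrable.of_bound (continuous_largeValue.measurable.comp
      ((hX t).const_smul x⁻¹ : Measurable fun ω => x⁻¹ • X t ω)).aestronglyMeasurable 1 (ae_of_all _ fun ω => ?_)) fun ω => ?_
  · rw [Real.norm_of_nonneg (largeValue_nonneg _)]
    exact largeValue_le_one _
  · by_cases hω : 2 * x < p (X t ω)
    · rw [Set.indicator_of_mem (by exact hω)]
      refine (largeValue_of_ge ?_).ge
      rw [map_smul_eq_mul, norm_inv, Real.norm_of_nonneg hx.le, inv_mul_eq_div, le_div_iff₀ hx]
      exact hω.le
    · rw [Set.indicator_of_notMem (by exact hω)]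
      exact largeValue_nonneg _

/-! ### From tail limits to joint regular variation -/

theorem StationaryField.exists_tendsto_of_tail (hp : ∀ v, p v = 0 → v = 0)
    (hX : ∀ t, Measurable (X t)) (h : StationaryField P X)
    (hrv : RegularlyVaryingVariable P (fun ω => p (X 0 ω)) α)
    (htail : ∀ (n : ℕ) (t : Fin n → Fin k → ℤ) (f : (Fin n → Fin d → ℝ) →ᵇ ℝ), ∃ a,
      Tendsto (fun x => ∫ ω, f (fun i => x⁻¹ • X (t i) ω) ∂(cond P {ω | x < p (X 0 ω)})) atTop
        (𝓝 a))
    {n : ℕ} (t : Fin n → Fin k → ℤ) (G : (Fin n → Fin d → ℝ) →ᵇ ℝ) {ε : ℝ} (hε : 0 < ε)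
    (hG : ∀ z, ‖z‖ < ε → G z = 0) :
    ∃ a, Tendsto (fun x => (P.real {ω | x < p (X 0 ω)})⁻¹ *
      ∫ ω, G (fun i => x⁻¹ • X (t i) ω) ∂P) atTop (𝓝 a) := by
  obtain ⟨c, hc, hcp⟩ := p.exists_mul_norm_le hp
  have hpc := p.continuous_of_finiteDimensional'
  -- If every p(zᵢ) ≤ 2e = cε/2, then ‖z‖ < ε and G vanishes. So where G ≠ 0 some weight `w i` is at
  -- least e, the floor in `D` is inactive, and the ratios `w i / D` sum to 1.
  set e : ℝ := c * ε / 4 with he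
  have he0 : 0 < e := by positivity
  have hlarge : ∀ z : Fin n → Fin d → ℝ, G z ≠ 0 → ∃ i, 2 * e < p (z i) := by
    intro z hz
    by_contra! hcon
    refine hz (hG z ((pi_norm_lt_iff hε).2 fun i => ?_))
    have h1 := (hcp (z i)).trans (hcon i)
    have h2 : c * ‖z i‖ < c * ε := by nlinarith [mul_pos hc hε]
    exact lt_of_mul_lt_mul_left h2 hc.le
  let w : Fin n → (Fin n → Fin d → ℝ) → ℝ := fun i z => max (p (z i) - e) 0
  let D : (Fin n → Fin d → ℝ) → ℝ := fun z => max (∑ i, w i z) e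
  have hD0 : ∀ z, 0 < D z := fun z => he0.trans_le (le_max_right _ _)
  have hw0 : ∀ i z, 0 ≤ w i z := fun i z => le_max_right _ _
  have hwD : ∀ i z, w i z ≤ D z := fun i z =>
    (Finset.single_le_sum (f := fun i => w i z) (fun j _ => hw0 j z) (Finset.mem_univ i)).trans
      (le_max_left _ _)
  have hwc : ∀ i, Continuous (w i) := fun i => by fun_prop
  have hDc : Continuous D := by fun_prop
  let H : Fin n → (Fin n → Fin d → ℝ) →ᵇ ℝ := fun i =>
    BoundedContinuousFunction.ofNormedAddCommGroup (fun z => G z * (w i z / D z))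
      (G.continuous.mul ((hwc i).div hDc fun z => (hD0 z).ne')) ‖G‖ fun z => by
        rw [norm_mul, Real.norm_of_nonneg (div_nonneg (hw0 i z) (hD0 z).le)]
        exact (mul_le_of_le_one_right (norm_nonneg _) ((div_le_one (hD0 z)).2 (hwD i z))).trans
          (G.norm_coe_le_norm z)
  have hHsum : ∀ z, G z = ∑ i, H i z := by
    intro z
    change G z = ∑ i, G z * (w i z / D z)
    rw [← Finset.mul_sum, ← Finset.sum_div]
    by_cases hz : G z = 0
    · simp [hz]
    · obtain ⟨i, hi⟩ := hlarge z hz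
      have h1 : e ≤ ∑ i, w i z := by
        refine le_trans ?_ (Finset.single_le_sum (f := fun i => w i z) (fun j _ => hw0 j z)
          (Finset.mem_univ i))
        exact le_max_of_le_left (by linarith)
      rw [show D z = ∑ i, w i z from max_eq_left h1, div_self (he0.trans_le h1).ne', mul_one]
  have hHsupp : ∀ i z, p (z i) ≤ e → H i z = 0 := fun i z hz => by
    change G z * (w i z / D z) = 0
    rw [show w i z = 0 from max_eq_right (by linarith), zero_div, mul_zero]
  have hmeas : ∀ (s : Fin n → Fin k → ℤ) (x : ℝ), Measurable fun ω i => x⁻¹ • X (s i) ω :=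
    fun s x => measurable_pi_lambda _ fun i => (hX (s i)).const_smul x⁻¹
  have hterm : ∀ i, ∃ a, Tendsto (fun x => (P.real {ω | x < p (X 0 ω)})⁻¹ *
      ∫ ω, H i (fun j => x⁻¹ • X (t j) ω) ∂P) atTop (𝓝 a) := by
    intro i
    -- Shifting by `t i` puts the i-th coordinate at the origin, where `H i` vanishes unless R > ex.
    -- The tail limit is therefore used at threshold ex, with the factor e undoing the rescaling.
    obtain ⟨a, ha⟩ := htail n (fun j => t j - t i)
      ((H i).compContinuous ⟨fun z => e • z, by fun_prop⟩)
    refine ⟨e ^ (-α) * a, Tendsto.congr' ?_ ((hrv.tendsto_ratio e he0).mul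
      (ha.comp (tendsto_id.const_mul_atTop he0)))⟩
    filter_upwards [eventually_gt_atTop 0] with x hx
    have h1 : ∫ ω, H i (fun j => x⁻¹ • X (t j) ω) ∂P =
        ∫ ω, H i (fun j => x⁻¹ • X (t j - t i) ω) ∂P :=
      h.integral_shift (t i) t (G := fun z => H i fun j => x⁻¹ • z j)
        ((H i).continuous.comp (by fun_prop)).measurable
    have h2 : ∫ ω in {ω | e * x < p (X 0 ω)}, H i (fun j => x⁻¹ • X (t j - t i) ω) ∂P =
        ∫ ω, H i (fun j => x⁻¹ • X (t j - t i) ω) ∂P := by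
      refine setIntegral_eq_integral_of_forall_compl_eq_zero fun ω hω => hHsupp i _ ?_
      have hω' : p (X 0 ω) ≤ e * x := not_lt.1 hω
      simp only [sub_self]
      rwa [map_smul_eq_mul, norm_inv, Real.norm_of_nonneg hx.le, inv_mul_eq_div,
        div_le_iff₀ hx]
    have h3 : ∀ ω, ((H i).compContinuous ⟨fun z => e • z, by fun_prop⟩)
        (fun j => (e * x)⁻¹ • X (t j - t i) ω) = H i (fun j => x⁻¹ • X (t j - t i) ω) := by
      intro ω
      change H i (e • fun j => (e * x)⁻¹ • X (t j - t i) ω) = _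
      congr 1
      ext j l
      simp only [Pi.smul_apply, smul_eq_mul]
      field_simp
    simp only [Function.comp_apply, id_eq]
    rw [integral_congr_ae (ae_of_all _ h3), integral_cond_eq, h1, ← h2]
    have := (hrv.tail_pos (e * x)).ne'
    field_simp
  choose a ha using hterm
  refine ⟨∑ i, a i, (tendsto_finsetSum _ fun i _ => ha i).congr fun x => ?_⟩
  rw [← Finset.mul_sum, ← integral_finsetSum]
  · simp_rw [hHsum]
  · exact fun i _ => Integrable.of_bound
      ((H i).continuous.measurable.comp (hmeas t x)).aestronglyMeasurable ‖H i‖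
      (ae_of_all _ fun ω => (H i).norm_coe_le_norm _)

end NormTails

/-! ### Joint regular variation from tail limits -/

section Joint

variable {Ω : Type*} [MeasurableSpace Ω] {P : Measure Ω} {k d : ℕ}
  {p : Seminorm ℝ (Fin d → ℝ)} {X : (Fin k → ℤ) → Ω → Fin d → ℝ} {α : ℝ}

/-- A measure on the punctured extended space has no mass at infinity if the scaled laws are
asymptotically tight at infinity. -/
theorem measure_infinite_eq_zero {J : Type*} [Fintype J] {ν : ℝ → Measure (PuncturedExtended J)}
    {μ : Measure (PuncturedExtended J)} [IsFiniteMeasureOnCompacts μ] (hνμ : VagueTendsto ν μ)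
    (h : ∀ η : ℝ, 0 < η → ∃ M : ℝ, 0 < M ∧ ∀ g : (J → EReal) → ℝ, Continuous g →
      (∀ y, g y ∈ Set.Icc (0 : ℝ) 1) → (∀ z : J → ℝ, ‖z‖ ≤ M → g (fun j => (z j : EReal)) = 0) →
      ∀ᶠ x in atTop, ∫ y, g y.1 ∂(ν x) ≤ η) :
    μ {y | ∃ j, y.1 j = ⊤ ∨ y.1 j = ⊥} = 0 := by
  refine le_antisymm (ENNReal.le_of_forall_pos_le_add fun η hη _ => ?_) bot_le
  rw [zero_add]
  obtain ⟨M, hM, hMg⟩ := h η (by exact_mod_cast hη)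
  have hA : IsClosed (Set.univ.pi fun _ : J => Set.Icc ((-M : ℝ) : EReal) (M : ℝ)) :=
    isClosed_set_pi fun _ _ => isClosed_Icc
  have hB : IsClosed {y : J → EReal | ∃ j, y j = ⊤ ∨ y j = ⊥} := by
    have : {y : J → EReal | ∃ j, y j = ⊤ ∨ y j = ⊥} = ⋃ j, (fun y => y j) ⁻¹' {⊤, ⊥} := by
      ext y
      simp
    rw [this]
    exact isClosed_iUnion_of_finite fun j =>
      (Set.toFinite _).isClosed.preimage (continuous_apply j)
  have hAB : Disjoint (Set.univ.pi fun _ : J => Set.Icc ((-M : ℝ) : EReal) (M : ℝ))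
      {y : J → EReal | ∃ j, y j = ⊤ ∨ y j = ⊥} := by
    refine Set.disjoint_left.2 fun y hy ⟨j, hj⟩ => ?_
    have h1 := hy j (Set.mem_univ j)
    rcases hj with hj | hj
    · rw [hj] at h1
      exact absurd h1.2 (not_le.2 (EReal.coe_lt_top M))
    · rw [hj] at h1
      exact absurd h1.1 (not_le.2 (EReal.bot_lt_coe (-M)))
  -- A Urysohn function that vanishes on the box [-M, M]^J and dominates the indicator of the
  -- infinite points.
  obtain ⟨g, hg0, hg1, hg⟩ := exists_continuous_zero_one_of_isClosed hA hB hAB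
  have hgM : ∀ z : J → ℝ, ‖z‖ ≤ M → g (fun j => (z j : EReal)) = 0 := fun z hz => by
    refine hg0 fun j _ => ?_
    have h1 := abs_le.1 ((norm_le_pi_norm z j).trans hz)
    exact ⟨EReal.coe_le_coe_iff.2 h1.1, EReal.coe_le_coe_iff.2 h1.2⟩
  have hgc : Continuous fun y : PuncturedExtended J => g y.1 :=
    g.continuous.comp continuous_subtype_val
  have hgs : HasCompactSupport fun y : PuncturedExtended J => g y.1 :=
    hasCompactSupport_comp_val hM fun z hz => hgM z hz.le
  have hle : ∫ y, g y.1 ∂μ ≤ η :=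
    le_of_tendsto (hνμ _ hgc hgs) (hMg g g.continuous hg hgM)
  have hint : Integrable (fun y : PuncturedExtended J => g y.1) μ :=
    hgc.integrable_of_hasCompactSupport hgs
  have hmeas : MeasurableSet {y : PuncturedExtended J | ∃ j, y.1 j = ⊤ ∨ y.1 j = ⊥} :=
    (hB.preimage continuous_subtype_val).measurableSet
  calc μ {y | ∃ j, y.1 j = ⊤ ∨ y.1 j = ⊥}
      = ∫⁻ y, {y : PuncturedExtended J | ∃ j, y.1 j = ⊤ ∨ y.1 j = ⊥}.indicator 1 y ∂μ :=
        (lintegral_indicator_one hmeas).symm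
    _ ≤ ∫⁻ y, ENNReal.ofReal (g y.1) ∂μ := by
        refine lintegral_mono fun y => ?_
        by_cases hy : y ∈ {y : PuncturedExtended J | ∃ j, y.1 j = ⊤ ∨ y.1 j = ⊥}
        · rw [Set.indicator_of_mem hy, show g y.1 = 1 from hg1 hy]
          simp
        · rw [Set.indicator_of_notMem hy]
          exact bot_le
    _ = ENNReal.ofReal (∫ y, g y.1 ∂μ) :=
        (ofReal_integral_eq_lintegral_ofReal hint (ae_of_all _ fun y => (hg y.1).1)).symm
    _ ≤ η := ENNReal.ofReal_le_of_le_toReal hle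

theorem integral_smul_scaledLaw {J : Type*} (Z : Ω → J → ℝ) {v : ℝ} (hv : 0 < v) (x : ℝ)
    (f : PuncturedExtended J → ℝ) :
    ∫ y, f y ∂(ENNReal.ofReal v⁻¹ • scaledLaw P Z x) = v⁻¹ * ∫ y, f y ∂(scaledLaw P Z x) := by
  rw [integral_smul_measure, ENNReal.toReal_ofReal (inv_nonneg.2 hv.le), smul_eq_mul]

variable [IsProbabilityMeasure P]

theorem StationaryField.jointlyRegularlyVarying (hp : ∀ v, p v = 0 → v = 0)
    (hX : ∀ t, Measurable (X t)) (h : StationaryField P X) (hα : 0 < α)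
    (hrv : RegularlyVaryingVariable P (fun ω => p (X 0 ω)) α)
    (htail : ∀ (n : ℕ) (t : Fin n → Fin k → ℤ) (f : (Fin n → Fin d → ℝ) →ᵇ ℝ), ∃ a,
      Tendsto (fun x => ∫ ω, f (fun i => x⁻¹ • X (t i) ω) ∂(cond P {ω | x < p (X 0 ω)})) atTop
        (𝓝 a)) :
    JointlyRegularlyVarying P X α := by
  intro n hn t
  obtain ⟨c, hc, hcp⟩ := p.exists_mul_norm_le hp
  set W : ℝ → ℝ := fun x => P.real {ω | x < p (X 0 ω)} with hWdef
  have hW : ∀ x, 0 < W x := hrv.tail_pos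
  set Z : Ω → Fin n × Fin d → ℝ := fun ω q => X (t q.1) ω q.2 with hZdef
  have hZ : Measurable Z := measurable_pi_lambda _ fun q => (measurable_pi_apply q.2).comp (hX _)
  have hlim : ∀ f : PuncturedExtended (Fin n × Fin d) → ℝ, Continuous f → HasCompactSupport f →
      ∃ a, Tendsto (fun x => ∫ y, f y ∂(ENNReal.ofReal (W x)⁻¹ • scaledLaw P Z x)) atTop
        (𝓝 a) := by
    intro f hf hfc
    obtain ⟨G, ε, hε, hG0, hG⟩ := exists_boundedContinuous_of_hasCompactSupport hf hfc
    have huc : ∀ z : Fin n → Fin d → ℝ, ‖fun q : Fin n × Fin d => z q.1 q.2‖ ≤ ‖z‖ := fun z =>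
      (pi_norm_le_iff_of_nonneg (norm_nonneg _)).2 fun q =>
        (norm_le_pi_norm (z q.1) q.2).trans (norm_le_pi_norm z q.1)
    obtain ⟨a, ha⟩ := h.exists_tendsto_of_tail hp hX hrv htail t
      (G.compContinuous ⟨fun z q => z q.1 q.2, by fun_prop⟩) hε
      fun z hz => hG0 _ ((huc z).trans_lt hz)
    refine ⟨a, ha.congr fun x => ?_⟩
    rw [integral_smul_scaledLaw Z (hW x), hG P hZ x]
    rfl
  have hfin : ∀ x, IsFiniteMeasure (ENNReal.ofReal (W x)⁻¹ • scaledLaw P Z x) := fun x =>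
    Measure.smul_finite _ ENNReal.ofReal_ne_top
  obtain ⟨μ, hμ, hν⟩ := exists_vagueTendsto (fun f hf hfc => hlim f hf hfc)
  refine ⟨W, μ, hrv, hμ, ?_, ?_, hν⟩
  -- For the zero measure the reference integrals would tend to 0, yet they dominate W(2x)/W(x),
  -- whose limit is 2^(-α) > 0.
  · rintro rfl
    obtain ⟨f, hfc, hf⟩ := exists_testFunction_largeValue hp (⟨0, hn⟩ : Fin n)
    have h1 := hν f f.continuous hfc
    rw [integral_zero_measure] at h1
    have h2 : (2 : ℝ) ^ (-α) ≤ 0 := by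
      refine le_of_tendsto_of_tendsto (hrv.tendsto_ratio 2 two_pos) h1 ?_
      filter_upwards [eventually_gt_atTop 0] with x hx
      rw [integral_smul_scaledLaw Z (hW x), hf P hZ x, div_eq_inv_mul]
      exact mul_le_mul_of_nonneg_left (h.le_integral_largeValue hX (t ⟨0, hn⟩) hx)
        (inv_nonneg.2 (hW x).le)
    exact absurd h2 (not_le.2 (by positivity))
  · refine measure_infinite_eq_zero hν fun η hη => ?_
    -- The union bound over n sites costs a factor n, and passing from the sup norm to `p` costs the
    -- factor c in the radius u / c.
    obtain ⟨u, hu1, hu⟩ := hrv.exists_small hα (show 0 < η / n by positivity)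
    refine ⟨u / c, by positivity, fun g hg hg01 hg0 => ?_⟩
    filter_upwards [hu, eventually_gt_atTop 0] with x hx hx0
    have hn0 : (0 : ℝ) < n := by exact_mod_cast hn
    have hnorm : MeasurableSet {ω | u / c * x < ‖fun i => X (t i) ω‖} :=
      measurableSet_lt measurable_const (measurable_pi_lambda _ fun i => hX (t i)).norm
    have h0 : g 0 = 0 := by
      have := hg0 0 (by simpa using by positivity)
      simpa [Pi.zero_def] using this
    have h1 : ∫ ω, g (fun j => ((x⁻¹ * Z ω j : ℝ) : EReal)) ∂P ≤
        P.real {ω | u / c * x < ‖fun i => X (t i) ω‖} := by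
      rw [← integral_indicator_one hnorm]
      refine integral_mono (Integrable.of_bound (hg.measurable.comp
        (measurable_scaled_coe hZ x)).aestronglyMeasurable 1 (ae_of_all _ fun ω => ?_))
        ((integrable_const _).indicator hnorm) fun ω => ?_
      · rw [Real.norm_of_nonneg (hg01 _).1]
        exact (hg01 _).2
      · by_cases hω : u / c * x < ‖fun i => X (t i) ω‖
        · rw [Set.indicator_of_mem (by exact hω)]
          exact (hg01 _).2
        · rw [Set.indicator_of_notMem (by exact hω)]
          refine (hg0 (fun j => x⁻¹ * Z ω j) ?_).le
          refine (pi_norm_le_iff_of_nonneg (by positivity)).2 fun q => ?_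
          rw [norm_mul, norm_inv, Real.norm_of_nonneg hx0.le, inv_mul_eq_div, div_le_iff₀ hx0]
          exact ((norm_le_pi_norm (X (t q.1) ω) q.2).trans
            (norm_le_pi_norm (fun i => X (t i) ω) q.1)).trans (not_lt.1 hω)
    have h2 := h.norm_tail_le hc hcp t (r := u / c * x) (by positivity)
    rw [show c * (u / c * x) = u * x by field_simp] at h2
    rw [integral_smul_scaledLaw Z (hW x), integral_scaledLaw P hZ x hg h0, inv_mul_le_iff₀ (hW x)]
    calc _ ≤ _ := h1
      _ ≤ _ := h2
      _ ≤ n * (η / n * W x) := mul_le_mul_of_nonneg_left hx hn0.le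
      _ = W x * η := by field_simp

end Joint

/-! ### Normalisation by the tail of the norm -/

theorem measure_eq_zero_of_integral_eq_zero {S : Type*} [TopologicalSpace S] [T2Space S]
    [LocallyCompactSpace S] [SecondCountableTopology S] [MeasurableSpace S] [BorelSpace S]
    {μ : Measure S} [IsFiniteMeasureOnCompacts μ]
    (h : ∀ f : S → ℝ, Continuous f → HasCompactSupport f → ∫ y, f y ∂μ = 0) : μ = 0 := by
  have hK : ∀ K : Set S, IsCompact K → μ K = 0 := fun K hK => by
    have := RealRMK.measure_le_of_isCompact_of_integral (μ := μ) (ν := 0)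
      (fun f => by simp [h f f.continuous f.hasCompactSupport]) hK
    simpa using this
  rw [← Measure.measure_univ_eq_zero, ← iUnion_compactCovering]
  exact measure_iUnion_null fun n => hK _ (isCompact_compactCovering S n)

section Normalise

variable {Ω : Type*} [MeasurableSpace Ω] {P : Measure Ω} [IsProbabilityMeasure P] {k d : ℕ}
  {p : Seminorm ℝ (Fin d → ℝ)} {X : (Fin k → ℤ) → Ω → Fin d → ℝ} {α : ℝ}

/-- By stationarity the integral depends only on the law of R, so the radial-angular limit applies
with a one-point angular space. Positivity comes from the lower bound W(2x)/W(x). -/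
theorem StationaryField.exists_tendsto_largeValue (hX : ∀ t, Measurable (X t))
    (h : StationaryField P X) (hα : 0 < α)
    (hrv : RegularlyVaryingVariable P (fun ω => p (X 0 ω)) α) (t : Fin k → ℤ) :
    ∃ b, 0 < b ∧ Tendsto (fun x => (P.real {ω | x < p (X 0 ω)})⁻¹ *
      ∫ ω, largeValue p (x⁻¹ • X t ω) ∂P) atTop (𝓝 b) := by
  let F : ℝ × Unit →ᵇ ℝ := BoundedContinuousFunction.ofNormedAddCommGroup
    (fun z => min (max (z.1 - 1) 0) 1) (by fun_prop) 1 fun z => by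
      rw [Real.norm_of_nonneg (by positivity)]
      exact min_le_right _ _
  have hRm : Measurable fun ω => p (X 0 ω) := p.measurable_comp (hX 0)
  have hcond := hrv.isProbabilityMeasure_cond
  have key := hrv.tendsto_radial_angular (Q := (Measure.dirac () : Measure Unit)) hRm hα
    (A := fun _ => ()) measurable_const (B := fun _ => ()) measurable_const
    (fun g => by simp) F
  have hev : ∀ᶠ x : ℝ in atTop, ∫ ω, F (x⁻¹ * p (X 0 ω), ()) ∂(cond P {ω | x < p (X 0 ω)}) =
      (P.real {ω | x < p (X 0 ω)})⁻¹ * ∫ ω, largeValue p (x⁻¹ • X t ω) ∂P := by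
    filter_upwards [eventually_gt_atTop 0] with x hx
    have h1 : ∫ ω, largeValue p (x⁻¹ • X t ω) ∂P = ∫ ω, largeValue p (x⁻¹ • X 0 ω) ∂P := by
      have := h.integral_shift t (fun _ : Fin 1 => t) (G := fun z => largeValue p (x⁻¹ • z 0))
        (continuous_largeValue.comp (by fun_prop)).measurable
      simpa using this
    have h2 : ∀ ω, largeValue p (x⁻¹ • X 0 ω) = F (x⁻¹ * p (X 0 ω), ()) := fun ω => by
      change min (max (p (x⁻¹ • X 0 ω) - 1) 0) 1 = min (max (x⁻¹ * p (X 0 ω) - 1) 0) 1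
      rw [map_smul_eq_mul, norm_inv, Real.norm_of_nonneg hx.le]
    rw [integral_cond_eq, h1, setIntegral_eq_integral_of_forall_compl_eq_zero]
    · simp_rw [h2]
    · intro ω hω
      rw [← h2]
      refine largeValue_of_le ?_
      rw [map_smul_eq_mul, norm_inv, Real.norm_of_nonneg hx.le, inv_mul_le_iff₀ hx, mul_one]
      exact not_lt.1 hω
  have hlim := key.congr' hev
  refine ⟨_, ?_, hlim⟩
  refine lt_of_lt_of_le (show (0 : ℝ) < 2 ^ (-α) by positivity)
    (le_of_tendsto_of_tendsto (hrv.tendsto_ratio 2 two_pos) hlim ?_)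
  filter_upwards [eventually_gt_atTop 0] with x hx
  rw [div_eq_inv_mul]
  exact mul_le_mul_of_nonneg_left (h.le_integral_largeValue hX t hx) (by positivity)

/-- The normalisation V is traded for W: integrals of one reference function, divided by V and by W,
both converge, so W/V converges, and its limit must be shown nonzero. -/
theorem StationaryField.exists_tendsto_of_regularlyVaryingVector (hp : ∀ v, p v = 0 → v = 0)
    (hX : ∀ t, Measurable (X t)) (h : StationaryField P X) (hα : 0 < α)
    (hrv : RegularlyVaryingVariable P (fun ω => p (X 0 ω)) α) {n : ℕ} (hn : 0 < n)
    (t : Fin n → Fin k → ℤ)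
    (ht : RegularlyVaryingVector P (fun ω (q : Fin n × Fin d) => X (t q.1) ω q.2) α)
    {G : (Fin n → Fin d → ℝ) → ℝ} (hG : Continuous G) {ε M : ℝ} (hε : 0 < ε)
    (hG0 : ∀ z, ‖z‖ < ε → G z = 0) (hGM : ∀ z, M < ‖z‖ → G z = 0) :
    ∃ a, Tendsto (fun x => (P.real {ω | x < p (X 0 ω)})⁻¹ *
      ∫ ω, G (fun i => x⁻¹ • X (t i) ω) ∂P) atTop (𝓝 a) := by
  obtain ⟨V, μ, hV, hμ, hμ0, -, hν⟩ := ht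
  obtain ⟨c, hc, hcp⟩ := p.exists_mul_norm_le hp
  set W : ℝ → ℝ := fun x => P.real {ω | x < p (X 0 ω)} with hWdef
  have hW : ∀ x, 0 < W x := hrv.tail_pos
  set Z : Ω → Fin n × Fin d → ℝ := fun ω q => X (t q.1) ω q.2 with hZdef
  have hZ : Measurable Z := measurable_pi_lambda _ fun q => (measurable_pi_apply q.2).comp (hX _)
  have hcurry : ∀ z : Fin n × Fin d → ℝ, ‖fun i j => z (i, j)‖ = ‖z‖ := fun z => by
    refine le_antisymm ((pi_norm_le_iff_of_nonneg (norm_nonneg _)).2 fun i =>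
      (pi_norm_le_iff_of_nonneg (norm_nonneg _)).2 fun j => norm_le_pi_norm z (i, j)) ?_
    exact (pi_norm_le_iff_of_nonneg (norm_nonneg _)).2 fun q =>
      (norm_le_pi_norm (fun j => z (q.1, j)) q.2).trans
        (norm_le_pi_norm (fun i j => z (i, j)) q.1)
  have hνV : ∀ f : PuncturedExtended (Fin n × Fin d) → ℝ, Continuous f → HasCompactSupport f →
      Tendsto (fun x => (V x)⁻¹ * ∫ y, f y ∂(scaledLaw P Z x)) atTop (𝓝 (∫ y, f y ∂μ)) := by
    intro f hf hfc
    refine (hν f hf hfc).congr' ?_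
    filter_upwards [eventually_gt_atTop 0] with x hx
    exact integral_smul_scaledLaw Z (hV.pos x hx) x f
  obtain ⟨b, hb, hLW⟩ := h.exists_tendsto_largeValue hX hα hrv (t ⟨0, hn⟩)
  obtain ⟨f₀, hf₀c, hf₀⟩ := exists_testFunction_largeValue hp (⟨0, hn⟩ : Fin n)
  have hLV := hνV f₀ f₀.continuous hf₀c
  have hWV : Tendsto (fun x => W x / V x) atTop (𝓝 ((∫ y, f₀ y ∂μ) / b)) := by
    refine (hLV.div hLW hb.ne').congr' ?_
    filter_upwards [eventually_gt_atTop 0] with x hx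
    have h1 : ∫ y, f₀ y ∂(scaledLaw P Z x) =
        ∫ ω, largeValue p (x⁻¹ • X (t ⟨0, hn⟩) ω) ∂P := hf₀ P hZ x
    have h2 : 0 < ∫ ω, largeValue p (x⁻¹ • X (t ⟨0, hn⟩) ω) ∂P :=
      (hW (2 * x)).trans_le (h.le_integral_largeValue hX _ hx)
    have h3 := hV.pos x hx
    have h4 := hW x
    rw [Pi.div_apply, h1]
    change _ / ((W x)⁻¹ * _) = _
    generalize ∫ ω, largeValue p (x⁻¹ • X (t ⟨0, hn⟩) ω) ∂P = L at h2 ⊢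
    field_simp
  -- If W/V → 0, every integral against μ is zero: a test function vanishing within distance δ of 0
  -- is controlled by the norm tail at δx/2, which is at most n·W(cδx/2) and so negligible against
  -- V. This contradicts μ ≠ 0.
  have ha0 : (∫ y, f₀ y ∂μ) / b ≠ 0 := by
    intro ha
    rw [ha] at hWV
    have hsc : SecondCountableTopology (PuncturedExtended (Fin n × Fin d)) :=
      IsEmbedding.subtypeVal.secondCountableTopology
    refine hμ0 (measure_eq_zero_of_integral_eq_zero fun f hf hfc => ?_)
    obtain ⟨K, δ, hδ, hK0, hK⟩ := exists_boundedContinuous_of_hasCompactSupport hf hfc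
    refine tendsto_nhds_unique (hνV f hf hfc) (squeeze_zero_norm' (a := fun x =>
      ‖K‖ * (n * (W (c * (δ / 2) * x) / W x * (W x / V x)))) ?_ ?_)
    · filter_upwards [eventually_gt_atTop 0] with x hx
      have hset : MeasurableSet {ω | δ / 2 * x < ‖fun i => X (t i) ω‖} :=
        measurableSet_lt measurable_const (measurable_pi_lambda _ fun i => hX (t i)).norm
      have h1 : ‖∫ ω, K (x⁻¹ • Z ω) ∂P‖ ≤
          ‖K‖ * P.real {ω | δ / 2 * x < ‖fun i => X (t i) ω‖} := by
        have h2 : ∫ ω in {ω | δ / 2 * x < ‖fun i => X (t i) ω‖}, K (x⁻¹ • Z ω) ∂P =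
            ∫ ω, K (x⁻¹ • Z ω) ∂P := by
          refine setIntegral_eq_integral_of_forall_compl_eq_zero fun ω hω => hK0 _ ?_
          have h3 : ‖Z ω‖ ≤ δ / 2 * x := (hcurry (Z ω)).symm.trans_le (not_lt.1 hω)
          rw [norm_smul, norm_inv, Real.norm_of_nonneg hx.le, inv_mul_lt_iff₀ hx]
          nlinarith
        rw [← h2]
        exact norm_setIntegral_le_of_norm_le_const (measure_lt_top _ _)
          fun ω _ => K.norm_coe_le_norm _
      have h2 := h.norm_tail_le hc hcp t (r := δ / 2 * x) (by positivity)
      have h3 := hV.pos x hx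
      rw [hK P hZ x, norm_mul, norm_inv, Real.norm_of_nonneg h3.le, inv_mul_le_iff₀ h3]
      refine h1.trans ?_
      have h4 : V x * (‖K‖ * (n * (W (c * (δ / 2) * x) / W x * (W x / V x)))) =
          ‖K‖ * (n * W (c * (δ / 2 * x))) := by
        have := (hW x).ne'
        rw [← mul_assoc c]
        field_simp
      rw [h4]
      exact mul_le_mul_of_nonneg_left h2 (norm_nonneg _)
    · have := (((hrv.tendsto_ratio (c * (δ / 2)) (by positivity)).mul hWV).const_mul
        (n : ℝ)).const_mul ‖K‖
      simpa using this
  have hVW : Tendsto (fun x => V x / W x) atTop (𝓝 ((∫ y, f₀ y ∂μ) / b)⁻¹) :=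
    (hWV.inv₀ ha0).congr fun x => by rw [inv_div]
  obtain ⟨f, hfc, hf⟩ := exists_testFunction_of_hasCompactSupport (J := Fin n × Fin d)
    (G := fun z => G fun i j => z (i, j)) (hG.comp (by fun_prop))
    (HasCompactSupport.intro (isCompact_closedBall 0 M) fun z hz =>
      hGM _ (by rw [hcurry]; simpa using hz)) hε fun z hz => hG0 _ (by rwa [hcurry])
  refine ⟨_, (hVW.mul (hνV f f.continuous hfc)).congr' ?_⟩
  filter_upwards [eventually_gt_atTop 0] with x hx
  have h1 := (hV.pos x hx).ne'
  have h2 : ∫ y, f y ∂(scaledLaw P Z x) = ∫ ω, G (fun i => x⁻¹ • X (t i) ω) ∂P := hf P hZ x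
  rw [h2]
  change V x / W x * _ = (W x)⁻¹ * _
  field_simp

end Normalise

/-! ### From joint regular variation to the angular limit -/

section Angular

variable {Ω : Type*} [MeasurableSpace Ω] {P : Measure Ω} [IsProbabilityMeasure P] {k d : ℕ}
  {p : Seminorm ℝ (Fin d → ℝ)} {X : (Fin k → ℤ) → Ω → Fin d → ℝ} {α : ℝ}

/-- Continuity of u ↦ u^(-α) at 1: a thin shell above the threshold carries little of the tail mass.
-/
theorem RegularlyVaryingVariable.exists_tail_near {R : Ω → ℝ} (h : RegularlyVaryingVariable P R α)
    {η : ℝ} (hη : 0 < η) : ∃ δ : ℝ, 0 < δ ∧ ∀ᶠ x in atTop,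
      P.real {ω | x < R ω} - P.real {ω | (1 + δ) * x < R ω} ≤ η * P.real {ω | x < R ω} := by
  have hcont : ContinuousAt (fun u : ℝ => u ^ (-α)) 1 :=
    Real.continuousAt_rpow_const _ _ (Or.inl one_ne_zero)
  have h1 : ∀ᶠ u : ℝ in 𝓝 1, 1 - η < u ^ (-α) := by
    refine hcont.eventually_const_lt ?_
    change 1 - η < (1 : ℝ) ^ (-α)
    rw [Real.one_rpow]
    linarith
  obtain ⟨r, hr, hball⟩ := Metric.eventually_nhds_iff.1 h1
  have h2 : 1 - η < (1 + r / 2) ^ (-α) := hball (by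
    rw [Real.dist_eq, add_sub_cancel_left, abs_of_pos (by positivity)]
    linarith)
  refine ⟨r / 2, by positivity, ?_⟩
  filter_upwards [(h.tendsto_ratio (1 + r / 2) (by positivity)).eventually_const_lt h2] with x hx
  have := (lt_div_iff₀ (h.tail_pos x)).1 hx
  linarith

/-- The indicator of R > x is discontinuous and F may be nonzero at infinity. A ramp φ in p(z₀) and
a cutoff χ in ‖z‖ repair both; the errors are the mass of the shell x < R ≤ (1+δ)x and of the region
where the vector exceeds Mx. -/
theorem StationaryField.exists_tendsto_cond (hp : ∀ v, p v = 0 → v = 0)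
    (hX : ∀ t, Measurable (X t)) (h : StationaryField P X) (hα : 0 < α)
    (hrv : RegularlyVaryingVariable P (fun ω => p (X 0 ω)) α) {n : ℕ}
    (t : Fin (n + 1) → Fin k → ℤ) (ht0 : t 0 = 0)
    (ht : RegularlyVaryingVector P (fun ω (q : Fin (n + 1) × Fin d) => X (t q.1) ω q.2) α)
    (F : (Fin (n + 1) → Fin d → ℝ) →ᵇ ℝ) :
    ∃ a, Tendsto (fun x => ∫ ω, F (fun i => x⁻¹ • X (t i) ω) ∂(cond P {ω | x < p (X 0 ω)}))
      atTop (𝓝 a) := by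
  obtain ⟨c, hc, hcp⟩ := p.exists_mul_norm_le hp
  obtain ⟨C, hC, hCp⟩ := p.exists_le_mul_norm
  have hpc := p.continuous_of_finiteDimensional'
  have hRm : Measurable fun ω => p (X 0 ω) := p.measurable_comp (hX 0)
  set W : ℝ → ℝ := fun x => P.real {ω | x < p (X 0 ω)} with hWdef
  have hW : ∀ x, 0 < W x := hrv.tail_pos
  refine exists_tendsto_of_approx fun η hη => ?_
  set B : ℝ := ‖F‖ + 1 with hB
  have hB0 : 0 < B := by positivity
  -- Shell and far region each receive η/2 after multiplication by the bound B; the far region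
  -- carries a further factor n + 1 from the union bound.
  obtain ⟨δ, hδ, hδev⟩ := hrv.exists_tail_near (show 0 < η / (2 * B) by positivity)
  obtain ⟨u, hu1, huev⟩ := hrv.exists_small hα (show 0 < η / (2 * B * (n + 1)) by positivity)
  set M : ℝ := u / c with hM
  let φ : ℝ → ℝ := fun r => min (max ((r - 1) / δ) 0) 1
  let χ : (Fin (n + 1) → Fin d → ℝ) → ℝ := fun z => min (max (M + 1 - ‖z‖) 0) 1
  have hφ01 : ∀ r, 0 ≤ φ r ∧ φ r ≤ 1 := fun r =>
    ⟨le_min (le_max_right _ _) zero_le_one, min_le_right _ _⟩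
  have hχ01 : ∀ z, 0 ≤ χ z ∧ χ z ≤ 1 := fun z =>
    ⟨le_min (le_max_right _ _) zero_le_one, min_le_right _ _⟩
  have hφ0 : ∀ r, r ≤ 1 → φ r = 0 := fun r hr => by
    have : (r - 1) / δ ≤ 0 := div_nonpos_of_nonpos_of_nonneg (by linarith) hδ.le
    simp [φ, max_eq_right this]
  have hφ1 : ∀ r, 1 + δ < r → φ r = 1 := fun r hr => by
    have : 1 ≤ (r - 1) / δ := (one_le_div hδ).2 (by linarith)
    simp only [φ]
    rw [max_eq_left (by linarith), min_eq_right this]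
  have hχ1 : ∀ z, ‖z‖ ≤ M → χ z = 1 := fun z hz => by
    simp only [χ]
    rw [max_eq_left (by linarith), min_eq_right (by linarith)]
  have hχ0 : ∀ z, M + 1 < ‖z‖ → χ z = 0 := fun z hz => by
    simp only [χ]
    rw [max_eq_right (by linarith), min_eq_left zero_le_one]
  let G : (Fin (n + 1) → Fin d → ℝ) → ℝ := fun z => F z * (φ (p (z 0)) * χ z)
  have hGc : Continuous G := by
    have := F.continuous
    fun_prop
  have hGb : ∀ z, |G z| ≤ B := fun z => by
    have h1 : |F z| ≤ B := (F.norm_coe_le_norm z).trans (by linarith)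
    have h2 : |φ (p (z 0)) * χ z| ≤ 1 := by
      rw [abs_of_nonneg (mul_nonneg (hφ01 _).1 (hχ01 _).1)]
      exact mul_le_one₀ (hφ01 _).2 (hχ01 _).1 (hχ01 _).2
    change |F z * _| ≤ B
    rw [abs_mul]
    nlinarith [abs_nonneg (F z)]
  refine ⟨_, h.exists_tendsto_of_regularlyVaryingVector hp hX hα hrv n.succ_pos t ht hGc
    (ε := 1 / C) (M := M + 1) (by positivity) (fun z hz => ?_) (fun z hz => ?_), ?_⟩
  · rw [lt_div_iff₀ hC] at hz
    have h1 : p (z 0) ≤ 1 := by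
      have := mul_le_mul_of_nonneg_left (norm_le_pi_norm z 0) hC.le
      linarith [hCp (z 0)]
    simp [G, hφ0 _ h1]
  · simp [G, hχ0 z hz]
  filter_upwards [hδev, huev, eventually_gt_atTop 0] with x hxδ hxu hx
  set Y : Ω → Fin (n + 1) → Fin d → ℝ := fun ω i => x⁻¹ • X (t i) ω with hY
  have hYm : Measurable Y := measurable_pi_lambda _ fun i => (hX (t i)).const_smul x⁻¹
  have hY0 : ∀ ω, p (Y ω 0) = x⁻¹ * p (X 0 ω) := fun ω => by
    simp only [hY, ht0]
    rw [map_smul_eq_mul, norm_inv, Real.norm_of_nonneg hx.le]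
  have hA : ∀ r : ℝ, MeasurableSet {ω | r < p (X 0 ω)} := fun r =>
    measurableSet_lt measurable_const hRm
  have hN : MeasurableSet {ω | M * x < ‖fun i => X (t i) ω‖} :=
    measurableSet_lt measurable_const (measurable_pi_lambda _ fun i => hX (t i)).norm
  have hFi : Integrable (fun ω => F (Y ω)) P := Integrable.of_bound
    (F.continuous.measurable.comp hYm).aestronglyMeasurable ‖F‖
    (ae_of_all _ fun ω => F.norm_coe_le_norm _)
  have hGi : Integrable (fun ω => G (Y ω)) P := Integrable.of_bound
    (hGc.measurable.comp hYm).aestronglyMeasurable B (ae_of_all _ fun ω => hGb _)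
  have hYn : ∀ ω, ‖fun i => X (t i) ω‖ ≤ M * x → ‖Y ω‖ ≤ M := fun ω hω => by
    rw [show Y ω = x⁻¹ • fun i => X (t i) ω from rfl, norm_smul, norm_inv,
      Real.norm_of_nonneg hx.le, inv_mul_le_iff₀ hx, mul_comm]
    exact hω
  have hpt : ∀ ω, |{ω | x < p (X 0 ω)}.indicator (fun ω => F (Y ω)) ω - G (Y ω)| ≤
      B * ({ω | x < p (X 0 ω)}.indicator 1 ω - {ω | (1 + δ) * x < p (X 0 ω)}.indicator 1 ω +
        {ω | M * x < ‖fun i => X (t i) ω‖}.indicator 1 ω) := by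
    intro ω
    have hnn : (0 : ℝ) ≤ {ω | M * x < ‖fun i => X (t i) ω‖}.indicator 1 ω :=
      Set.indicator_nonneg (fun _ _ => zero_le_one) _
    by_cases h1 : x < p (X 0 ω)
    · rw [Set.indicator_of_mem (by exact h1), Set.indicator_of_mem (by exact h1)]
      have hdiff : |F (Y ω) - G (Y ω)| ≤ B := by
        have h3 : F (Y ω) - G (Y ω) = F (Y ω) * (1 - φ (p (Y ω 0)) * χ (Y ω)) := by
          simp only [G]
          ring
        have h4 : 0 ≤ φ (p (Y ω 0)) * χ (Y ω) := mul_nonneg (hφ01 _).1 (hχ01 _).1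
        have h5 : φ (p (Y ω 0)) * χ (Y ω) ≤ 1 :=
          mul_le_one₀ (hφ01 _).2 (hχ01 _).1 (hχ01 _).2
        have h6 : |F (Y ω)| ≤ B := (F.norm_coe_le_norm _).trans (by linarith)
        rw [h3, abs_mul, abs_of_nonneg (show 0 ≤ 1 - φ (p (Y ω 0)) * χ (Y ω) by linarith)]
        nlinarith [abs_nonneg (F (Y ω))]
      by_cases h2 : (1 + δ) * x < p (X 0 ω)
      · rw [Set.indicator_of_mem (by exact h2)]
        by_cases h3 : M * x < ‖fun i => X (t i) ω‖
        · rw [Set.indicator_of_mem (by exact h3)]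
          simpa using hdiff
        · rw [Set.indicator_of_notMem (by exact h3)]
          have h4 : 1 + δ < p (Y ω 0) := by
            rw [hY0, inv_mul_eq_div, lt_div_iff₀ hx]
            exact h2
          simp [G, hφ1 _ h4, hχ1 _ (hYn ω (not_lt.1 h3))]
      · rw [Set.indicator_of_notMem (s := {ω | (1 + δ) * x < p (X 0 ω)}) (by exact h2)]
        refine hdiff.trans (le_mul_of_one_le_right hB0.le ?_)
        simp only [Pi.one_apply]
        linarith
    · have h2 : ¬ (1 + δ) * x < p (X 0 ω) := fun h2 => h1 (lt_of_le_of_lt (by nlinarith) h2)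
      have h3 : p (Y ω 0) ≤ 1 := by
        rw [hY0, inv_mul_le_iff₀ hx, mul_one]
        exact not_lt.1 h1
      rw [Set.indicator_of_notMem (by exact h1), Set.indicator_of_notMem (by exact h1),
        Set.indicator_of_notMem (by exact h2)]
      simp only [G, hφ0 _ h3, zero_mul, mul_zero, sub_zero, abs_zero, zero_add]
      exact mul_nonneg hB0.le hnn
  have hbound : |∫ ω in {ω | x < p (X 0 ω)}, F (Y ω) ∂P - ∫ ω, G (Y ω) ∂P| ≤
      B * (W x - W ((1 + δ) * x) + P.real {ω | M * x < ‖fun i => X (t i) ω‖}) := by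
    rw [← integral_indicator (hA x), ← integral_sub (hFi.indicator (hA x)) hGi]
    refine abs_integral_le_integral_abs.trans ?_
    have hi : ∀ {s : Set Ω}, MeasurableSet s → Integrable (s.indicator (1 : Ω → ℝ)) P :=
      fun hs => (integrable_const (1 : ℝ)).indicator hs
    calc _ ≤ ∫ ω, B * ({ω | x < p (X 0 ω)}.indicator 1 ω -
          {ω | (1 + δ) * x < p (X 0 ω)}.indicator 1 ω +
          {ω | M * x < ‖fun i => X (t i) ω‖}.indicator 1 ω) ∂P :=
        integral_mono ((hFi.indicator (hA x)).sub hGi).abs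
          ((((hi (hA _)).sub (hi (hA _))).add (hi hN)).const_mul B) hpt
      _ = _ := by
        have hs : Integrable (fun ω => {ω | x < p (X 0 ω)}.indicator (1 : Ω → ℝ) ω -
            {ω | (1 + δ) * x < p (X 0 ω)}.indicator 1 ω) P := (hi (hA _)).sub (hi (hA _))
        rw [integral_const_mul, integral_add hs (hi hN),
          integral_sub (hi (hA _)) (hi (hA _)), integral_indicator_one (hA _),
          integral_indicator_one (hA _), integral_indicator_one hN]
  have htail := h.norm_tail_le hc hcp t (r := M * x) (by positivity)
  rw [show c * (M * x) = u * x by rw [hM]; field_simp] at htail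
  have h7 : P.real {ω | M * x < ‖fun i => X (t i) ω‖} ≤ η / (2 * B) * W x := by
    refine htail.trans ((mul_le_mul_of_nonneg_left hxu (by positivity)).trans_eq ?_)
    push_cast
    change _ * (_ * W x) = _
    field_simp
  have h8 : B * (W x - W ((1 + δ) * x) + P.real {ω | M * x < ‖fun i => X (t i) ω‖}) ≤
      η * W x := by
    have h9 : W x - W ((1 + δ) * x) ≤ η / (2 * B) * W x := hxδ
    calc _ ≤ B * (η / (2 * B) * W x + η / (2 * B) * W x) :=
          mul_le_mul_of_nonneg_left (add_le_add h9 h7) hB0.le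
      _ = η * W x := by field_simp; ring
  rw [integral_cond_eq, ← mul_sub, abs_mul, abs_inv, abs_of_pos (hW x), inv_mul_le_iff₀ (hW x),
    mul_comm (W x)]
  exact hbound.trans h8

/-- The origin is prepended to the sites so that the normaliser is a function of the vector.
Dividing by max(p(z₀), 1) is continuous everywhere and agrees with dividing by p(z₀) on R > x. -/
theorem StationaryField.exists_tendsto_angular (hp : ∀ v, p v = 0 → v = 0)
    (hX : ∀ t, Measurable (X t)) (h : StationaryField P X) (hα : 0 < α)
    (hrv : RegularlyVaryingVariable P (fun ω => p (X 0 ω)) α)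
    (hJ : JointlyRegularlyVarying P X α) {n : ℕ} (t : Fin n → Fin k → ℤ)
    (f : (Fin n → Fin d → ℝ) →ᵇ ℝ) :
    ∃ a, Tendsto (fun x => ∫ ω, f (fun i => (p (X 0 ω))⁻¹ • X (t i) ω)
      ∂(cond P {ω | x < p (X 0 ω)})) atTop (𝓝 a) := by
  have hpc := p.continuous_of_finiteDimensional'
  have hmax0 : ∀ z : Fin (n + 1) → Fin d → ℝ, max (p (z 0)) 1 ≠ 0 := fun z => by positivity
  have hmaxc : Continuous fun z : Fin (n + 1) → Fin d → ℝ => (max (p (z 0)) 1)⁻¹ :=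
    Continuous.inv₀ (by fun_prop) hmax0
  let F : (Fin (n + 1) → Fin d → ℝ) →ᵇ ℝ := f.compContinuous
    ⟨fun z i => (max (p (z 0)) 1)⁻¹ • z i.succ, by fun_prop⟩
  obtain ⟨a, ha⟩ := h.exists_tendsto_cond hp hX hα hrv (Fin.cons 0 t : Fin (n + 1) → Fin k → ℤ)
    rfl (hJ (n + 1) n.succ_pos _) F
  refine ⟨a, ha.congr' ?_⟩
  filter_upwards [eventually_gt_atTop 0] with x hx
  refine integral_congr_ae (ae_cond_of_forall_mem
    (measurableSet_lt measurable_const (p.measurable_comp (hX 0))) fun ω hω => ?_)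
  have hω' : x < p (X 0 ω) := hω
  have hmax : max (p (x⁻¹ • X 0 ω)) 1 = x⁻¹ * p (X 0 ω) := by
    rw [map_smul_eq_mul, norm_inv, Real.norm_of_nonneg hx.le, max_eq_left]
    rw [inv_mul_eq_div, one_le_div hx]
    exact hω'.le
  change f (fun i => (max (p (x⁻¹ • X 0 ω)) 1)⁻¹ • x⁻¹ • X (t i) ω) = _
  congr 1
  funext i
  rw [hmax, smul_smul]
  congr 1
  have := (hx.trans hω').ne'
  field_simp

/-- On R > x, a ratio larger than M/c forces p(X(t)) > Mx, and stationarity makes that as unlikely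
as R > Mx. -/
theorem StationaryField.cond_angular_tail_le (hX : ∀ t, Measurable (X t))
    (h : StationaryField P X) (hrv : RegularlyVaryingVariable P (fun ω => p (X 0 ω)) α)
    {c : ℝ} (hc : 0 < c) (hcp : ∀ v, c * ‖v‖ ≤ p v) (t : Fin k → ℤ) {M ε x : ℝ} (hM : 0 ≤ M)
    (hx : 0 < x)
    (hMε : P.real {ω | M * x < p (X 0 ω)} ≤ ε * P.real {ω | x < p (X 0 ω)}) :
    (cond P {ω | x < p (X 0 ω)}) {ω | M / c < ‖(p (X 0 ω))⁻¹ • X t ω‖} ≤ ENNReal.ofReal ε := by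
  have hset : MeasurableSet {ω | x < p (X 0 ω)} :=
    measurableSet_lt measurable_const (p.measurable_comp (hX 0))
  have hcond := hrv.isProbabilityMeasure_cond x
  rw [← ofReal_measureReal]
  refine ENNReal.ofReal_le_ofReal ?_
  have hsub : {ω | x < p (X 0 ω)} ∩ {ω | M / c < ‖(p (X 0 ω))⁻¹ • X t ω‖} ⊆
      {ω | M * x < p (X t ω)} := by
    rintro ω ⟨h1, h2⟩
    have h1' : x < p (X 0 ω) := h1
    have h0 : 0 < p (X 0 ω) := hx.trans h1'
    have h2' : M / c < ‖(p (X 0 ω))⁻¹ • X t ω‖ := h2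
    rw [norm_smul, norm_inv, Real.norm_of_nonneg h0.le, inv_mul_eq_div,
      div_lt_div_iff₀ hc h0] at h2'
    change M * x < p (X t ω)
    have := hcp (X t ω)
    nlinarith
  rw [measureReal_def, cond_apply hset, ENNReal.toReal_mul, ENNReal.toReal_inv,
    ← measureReal_def, ← measureReal_def, inv_mul_le_iff₀ (hrv.tail_pos x), mul_comm _ ε]
  refine (measureReal_mono hsub).trans ?_
  rw [h.tail_eq t]
  exact hMε

theorem StationaryField.exists_angularLimit (hp : ∀ v, p v = 0 → v = 0)
    (hX : ∀ t, Measurable (X t)) (h : StationaryField P X) (hα : 0 < α)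
    (hrv : RegularlyVaryingVariable P (fun ω => p (X 0 ω)) α)
    (hJ : JointlyRegularlyVarying P X α) :
    ∃ Q : Measure ((Fin k → ℤ) → Fin d → ℝ), IsProbabilityMeasure Q ∧
      AngularLimit p P X Q fun t y => y t := by
  obtain ⟨c, hc, hcp⟩ := p.exists_mul_norm_le hp
  have hRm : Measurable fun ω => p (X 0 ω) := p.measurable_comp (hX 0)
  have hcond := hrv.isProbabilityMeasure_cond
  have hA : Measurable fun ω t => (p (X 0 ω))⁻¹ • X t ω :=
    measurable_pi_lambda _ fun t => hRm.inv.smul (hX t)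
  let μ : ℝ → ProbabilityMeasure ((Fin k → ℤ) → Fin d → ℝ) := fun x =>
    ⟨(cond P {ω | x < p (X 0 ω)}).map fun ω t => (p (X 0 ω))⁻¹ • X t ω,
      Measure.isProbabilityMeasure_map hA.aemeasurable⟩
  have htight : IsTightMeasureSet
      {((ν : ProbabilityMeasure ((Fin k → ℤ) → Fin d → ℝ)) :
        Measure ((Fin k → ℤ) → Fin d → ℝ)) |
        ν ∈ μ '' Set.Ici 1} := by
    rw [isTightMeasureSet_iff_exists_isCompact_measure_compl_le]
    intro ε hε
    -- The index set ℤ^k is countable, so ε can be split over the sites; the compact set is a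
    -- product of closed balls.
    obtain ⟨ε', hε', hsum⟩ := ENNReal.exists_pos_sum_of_countable hε.ne' (Fin k → ℤ)
    have hM := fun t => hrv.exists_uniform_small hα (show (0 : ℝ) < ε' t by exact_mod_cast hε' t)
    choose M hM1 hMtail using hM
    refine ⟨Set.univ.pi fun t => Metric.closedBall 0 (M t / c),
      isCompact_univ_pi fun t => isCompact_closedBall _ _, ?_⟩
    rintro _ ⟨_, ⟨x, hx, rfl⟩, rfl⟩
    have hx1 : (1 : ℝ) ≤ x := hx
    have hcompl : (Set.univ.pi fun t : Fin k → ℤ =>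
        Metric.closedBall (0 : Fin d → ℝ) (M t / c))ᶜ ⊆ ⋃ t, {y | M t / c < ‖y t‖} := by
      intro y hy
      by_contra hcon
      simp only [Set.mem_iUnion, Set.mem_ofPred_eq, not_exists, not_lt] at hcon
      exact hy fun t _ => by simpa using hcon t
    calc _ ≤ (μ x : Measure ((Fin k → ℤ) → Fin d → ℝ)) (⋃ t, {y | M t / c < ‖y t‖}) := measure_mono hcompl
      _ ≤ ∑' t, (μ x : Measure ((Fin k → ℤ) → Fin d → ℝ)) {y | M t / c < ‖y t‖} := measure_iUnion_le _
      _ ≤ ∑' t, (ε' t : ENNReal) := by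
          refine ENNReal.tsum_le_tsum fun t => ?_
          change ((cond P {ω | x < p (X 0 ω)}).map _) _ ≤ _
          rw [Measure.map_apply hA
            (measurableSet_lt measurable_const (measurable_pi_apply t).norm)]
          refine (h.cond_angular_tail_le hX hrv hc hcp t (by linarith [hM1 t]) (by linarith)
            (hMtail t x hx1)).trans_eq ?_
          exact ENNReal.ofReal_coe_nnreal
      _ ≤ ε := hsum.le
  have hev : map μ atTop ≤ 𝓟 (closure (μ '' Set.Ici 1)) := by
    rw [le_principal_iff, mem_map]
    filter_upwards [eventually_ge_atTop 1] with x hx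
    exact subset_closure ⟨x, hx, rfl⟩
  obtain ⟨Q, -, hQ⟩ := (isCompact_closure_of_isTightMeasureSet htight).exists_mapClusterPt hev
  -- A cluster point suffices: finite-dimensional expectations already converge, so their limits can
  -- be read off along an ultrafilter converging to Q.
  obtain ⟨U, hU, hUQ⟩ := mapClusterPt_iff_ultrafilter.1 hQ
  refine ⟨Q, inferInstance, fun n t f => ?_⟩
  obtain ⟨a, ha⟩ := h.exists_tendsto_angular hp hX hα hrv hJ t f
  let g : ((Fin k → ℤ) → Fin d → ℝ) →ᵇ ℝ :=
    f.compContinuous ⟨fun y i => y (t i), by fun_prop⟩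
  have h1 := ProbabilityMeasure.tendsto_iff_forall_integral_tendsto.1 hUQ g
  have h2 : ∀ x, ∫ y, g y ∂(μ x : Measure ((Fin k → ℤ) → Fin d → ℝ)) =
      ∫ ω, f (fun i => (p (X 0 ω))⁻¹ • X (t i) ω) ∂(cond P {ω | x < p (X 0 ω)}) := fun x =>
    integral_map hA.aemeasurable g.continuous.measurable.aestronglyMeasurable
  simp_rw [h2] at h1
  have h3 : a = ∫ y, g y ∂(Q : Measure ((Fin k → ℤ) → Fin d → ℝ)) :=
    tendsto_nhds_unique (ha.mono_left hU) h1
  rw [h3] at ha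
  exact ha

end Angular

/-! ### The equivalence and the spectral field -/

theorem proposition3p1 {Ω : Type*} [MeasurableSpace Ω] (P : Measure Ω) [IsProbabilityMeasure P]
    {k d : ℕ}
    -- an arbitrary norm on `ℝ^d`
    (p : Seminorm ℝ (Fin d → ℝ)) (hp : ∀ v, p v = 0 → v = 0)
    (X : (Fin k → ℤ) → Ω → Fin d → ℝ) (hX : ∀ t, Measurable (X t))
    (hstat : StationaryField P X)
    (α : ℝ) (hα : 0 < α)
    (hrv : RegularlyVaryingVariable P (fun ω => p (X 0 ω)) α) :
    (JointlyRegularlyVarying P X α ↔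
      ∃ (Ω' : Type) (_ : MeasurableSpace Ω') (Q : Measure Ω')
        (Θ : (Fin k → ℤ) → Ω' → Fin d → ℝ),
        IsProbabilityMeasure Q ∧ (∀ t, Measurable (Θ t)) ∧ AngularLimit p P X Q Θ) ∧
    (∀ (Ω' : Type) [MeasurableSpace Ω'] (Q : Measure Ω') [IsProbabilityMeasure Q]
        (Θ : (Fin k → ℤ) → Ω' → Fin d → ℝ),
        (∀ t, Measurable (Θ t)) → AngularLimit p P X Q Θ → IsSpectralField p P X α Q Θ) := by
  refine ⟨⟨fun hJ => ?_, ?_⟩, fun Ω' _ Q _ Θ hΘ h => h.isSpectralField hX hα hrv hΘ⟩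
  · obtain ⟨Q, hQ, h⟩ := hstat.exists_angularLimit hp hX hα hrv hJ
    exact ⟨(Fin k → ℤ) → Fin d → ℝ, inferInstance, Q, fun t y => y t, hQ,
      fun t => measurable_pi_apply t, h⟩
  · rintro ⟨Ω', _, Q, Θ, hQ, hΘ, h⟩
    exact hstat.jointlyRegularlyVarying hp hX hα hrv fun n t f =>
      ⟨_, h.fddTendsto_pareto_smul hX hα hrv hΘ n t f⟩
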